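/- A topological graph $E=(E^0,E^1,r,s)$ consists of locally compact Hausdorff spaces $E^0,E^1$, a continuous map $r:E^1\to E^0$ and a local homeomorphism $s:E^1\to E^0$. Let $E^0_{\mathrm{reg}}\subseteq E^0$ be the largest open set $U$ such that $r$ restricts to a proper surjection $r^{-1}(U)\to U$. Let $H(E)$ be the $C^*$-correspondence over $C_0(E^0)$ obtained by completing $C_c(E^1)$ for the inner product $\langle\xi,\eta\rangle(v)=\sum_{s(e)=v}\overline{\xi(e)}\,\eta(e)$, with actions $a\cdot\xi=(a\circ r)\xi$ and $\xi\cdot a=\xi\,(a\circ s)$. A Toeplitz representation of $E$ on a $C^*$-algebra $A$ is a pair $(\pi^0,\pi^1)$ of a $*$-homomorphism $\pi^0:C_0(E^0)\to A$ and a linear map $\pi^1:H(E)\to A$ with $\pi^1(\xi)^*\pi^1(\eta)=\pi^0(\langle\xi,\eta\rangle)$ and $\pi^0(a)\pi^1(\xi)=\pi^1(a\cdot\xi)$. It induces $\varphi:\mathbb K(H(E))\to A$ with $\varphi(\xi\otimes\eta^*)=\pi^1(\xi)\pi^1(\eta)^*$, and it is covariant if $\varphi(\lambda(a\circ r))=\pi^0(a)$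 for all $a\in C_0(E^0_{\mathrm{reg}})$, where $\lambda$ denotes pointwise multiplication. $C^*(E)$ is the universal $C^*$-algebra generated by a covariant representation $(\pi^0,\pi^1)$ of $E$, and the gauge action $\gamma$ of the circle group $\mathbb T$ on $C^*(E)$ is determined by $\gamma_z(\pi^0(a))=\pi^0(a)$ and $\gamma_z(\pi^1(\xi))=z\,\pi^1(\xi)$. A cycle in $E$ is a path $\alpha=\alpha_1\cdots\alpha_n$ with $n\ge 1$, $\alpha_i\in E^1$, $s(\alpha_i)=r(\alpha_{i+1})$ for $1\le i<n$, and $s(\alpha):=s(\alpha_n)=r(\alpha_1)$. **Proposition.** Let $E$ be a topological graph, let $\tau$ be a tracial state on $C^*(E)$ (a positive linear functional of norm one with $\tau(xy)=\tau(yx)$), and let $\mu$ be the Radon measure on $E^0$ induced by $\tau$, that is, the Radon measure given by the Riesz representation theorem with $\tau(\pi^0(a))=\int_{E^0}a\,d\mu$ for all $a\in C_0(E^0)$. If $s(\alpha)\notin\operatorname{supp}(\mu)$ for every cycle $\alpha$ in $E$, then $\tau$ is gauge invariant: $\tau(\gamma_z(x))=\tau(x)$ for all $z\in\mathbb T$ and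 $x\in C^*(E)$. -/

import Mathlib

open Topology CompactlySupported ZeroAtInfty BoundedContinuousFunction

universe u v

set_option linter.unusedSectionVars false

/-- A topological graph on the vertex space `V` and the edge space `W` (locally compact Hausdorff
spaces): a continuous range map `r` and a source map `s` that is a local homeomorphism. -/
structure TopologicalGraph (V : Type u) (W : Type v) [TopologicalSpace V] [LocallyCompactSpace V]
    [T2Space V] [TopologicalSpace W] [LocallyCompactSpace W] [T2Space W] where
  /-- The range map. -/
  r : W → V
  /-- The source map. -/
  s : W → V
  continuous_r : Continuous r
  isLocalHomeomorph_s : IsLocalHomeomorph s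

namespace TopologicalGraph

noncomputable section

variable {V : Type u} {W : Type v} [TopologicalSpace V] [LocallyCompactSpace V] [T2Space V]
  [TopologicalSpace W] [LocallyCompactSpace W] [T2Space W] (E : TopologicalGraph V W)

lemma continuous_s : Continuous E.s := E.isLocalHomeomorph_s.continuous

/-- A cycle: a path `α₁ ⋯ αₖ` of length `k = n + 1 ≥ 1`, i.e. `s(αᵢ) = r(αᵢ₊₁)` for
`i = 1, …, k - 1`, whose source `s(αₖ)` equals its range `r(α₁)`. -/
def IsCycle {n : ℕ} (α : Fin (n + 1) → W) : Prop :=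
  (∀ i : Fin n, E.s (α i.castSucc) = E.r (α i.succ)) ∧ E.s (α (Fin.last n)) = E.r (α 0)

/-- The regular vertices: the largest open set `U` of vertices such that `r` restricts to a proper
surjection `r⁻¹(U) → U`. -/
def regular : Set V :=
  ⋃₀ {U : Set V | IsOpen U ∧ IsProperMap (U.restrictPreimage E.r) ∧
    Function.Surjective (U.restrictPreimage E.r)}

/-- The sum `∑_{s(e) = v} f(e)` over the edges with source `v`. -/
def fiberSumFun (f : W → ℂ) (v : V) : ℂ := ∑ᶠ e : {e : W // E.s e = v}, f e

lemma finite_fiber (f : C_c(W, ℂ)) (v : V) :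
    (Function.support fun e : {e : W // E.s e = v} => f e).Finite := by
  classical
  have hK : IsCompact (tsupport f) := f.hasCompactSupport
  have h : ∀ x : W, ∃ U : Set W, IsOpen U ∧ x ∈ U ∧ Set.InjOn E.s U := by
    intro x
    obtain ⟨e, hx, he⟩ := E.isLocalHomeomorph_s x
    exact ⟨e.source, e.open_source, hx, he ▸ e.injOn⟩
  choose U hUo hxU hU using h
  obtain ⟨t, ht⟩ := hK.elim_finite_subcover U hUo (fun x _ => Set.mem_iUnion.2 ⟨x, hxU x⟩)
  have h2 : (⋃ x ∈ t, {e : {e : W // E.s e = v} | (e : W) ∈ U x}).Finite := by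
    refine t.finite_toSet.biUnion fun x _ => Set.Subsingleton.finite ?_
    intro a ha b hb
    exact Subtype.ext (hU x ha hb (a.2.trans b.2.symm))
  refine h2.subset fun e he => ?_
  have := ht (subset_tsupport _ he)
  simpa using this

lemma fiberSumFun_sum {n : ℕ} (g : Fin n → C_c(W, ℂ)) (v : V) :
    E.fiberSumFun (fun e => ∑ i, g i e) v = ∑ i, E.fiberSumFun (g i) v := by
  unfold fiberSumFun
  rw [finsum_sum_comm]
  intro i _
  exact E.finite_fiber (g i) v

lemma fiberSumFun_eq_zero {f : W → ℂ} {v : V} (hv : v ∉ E.s '' Function.support f) :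
    E.fiberSumFun f v = 0 := by
  unfold fiberSumFun
  have : (fun e : {e : W // E.s e = v} => f e) = fun _ => 0 := by
    ext e
    by_contra h
    exact hv ⟨e, h, e.2⟩
  rw [this, finsum_zero]

/-- A compactly supported function is a finite sum of compactly supported functions, each of them
supported in an open set on which the source map is injective. -/
lemma exists_chart_decomposition (f : C_c(W, ℂ)) :
    ∃ (n : ℕ) (g η : Fin n → C_c(W, ℂ)), (∀ e, f e = ∑ i, g i e) ∧
      (∀ i, ∃ φ : OpenPartialHomeomorph W V, E.s = φ ∧ tsupport (g i) ⊆ φ.source ∧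
        tsupport (η i) ⊆ φ.source) ∧ (∀ i e, g i e * η i e = g i e) := by
  classical
  have hK : IsCompact (tsupport f) := f.hasCompactSupport
  choose φ hxφ hφ using E.isLocalHomeomorph_s
  obtain ⟨t, ht⟩ := hK.elim_finite_subcover (fun x => (φ x).source)
    (fun x => (φ x).open_source) (fun x _ => Set.mem_iUnion.2 ⟨x, hxφ x⟩)
  let c : Fin t.card → W := fun i => (t.equivFin.symm i : W)
  have hc : tsupport f ⊆ ⋃ i, (φ (c i)).source := by
    intro x hx
    obtain ⟨y, hy, hxy⟩ := Set.mem_iUnion₂.1 (ht hx)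
    refine Set.mem_iUnion.2 ⟨t.equivFin ⟨y, hy⟩, ?_⟩
    simpa [c] using hxy
  obtain ⟨χ, hχs, hχ1, -, hχc⟩ :=
    exists_continuous_sum_one_of_isOpen_isCompact (fun i => (φ (c i)).open_source) hK hc
  have hη : ∀ i, ∃ η : C(W, ℝ), Set.EqOn η 1 (tsupport (χ i)) ∧ HasCompactSupport η ∧
      tsupport η ⊆ (φ (c i)).source := by
    intro i
    obtain ⟨K, hKc, hK1, hK2⟩ := exists_compact_between (hχc i) (φ (c i)).open_source (hχs i)
    obtain ⟨η, h1, h2, h3, -⟩ := exists_continuous_one_zero_of_isCompact (hχc i)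
      (isOpen_interior (s := K)).isClosed_compl (Set.disjoint_compl_right_iff_subset.2 hK1)
    have hts : tsupport η ⊆ K := by
      refine closure_minimal (fun x hx => ?_) hKc.isClosed
      by_contra hxK
      exact hx (h2 fun h => hxK (interior_subset h))
    exact ⟨η, h1, h3, hts.trans hK2⟩
  choose η hη1 hηc hηs using hη
  refine ⟨t.card, fun i => ⟨⟨fun e => (χ i e : ℂ) * f e, by fun_prop⟩,
      HasCompactSupport.mul_left (f := fun e => (χ i e : ℂ)) (f' := f) f.hasCompactSupport⟩,
    fun i => ⟨⟨fun e => (η i e : ℂ), by fun_prop⟩,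
      (hηc i).comp_left (g := fun x : ℝ => (x : ℂ)) (by simp)⟩, ?_, ?_, ?_⟩
  · intro e
    simp only [CompactlySupportedContinuousMap.coe_mk, ContinuousMap.coe_mk]
    rw [← Finset.sum_mul]
    by_cases he : f e = 0
    · simp [he]
    · have := hχ1 (subset_tsupport _ he)
      simp only [Finset.sum_apply, Pi.one_apply] at this
      rw [← Complex.ofReal_sum, this]
      simp
  · intro i
    refine ⟨φ (c i), hφ _, ?_, ?_⟩
    · refine subset_trans (closure_mono fun x hx => ?_) (hχs i)
      simp only [CompactlySupportedContinuousMap.coe_mk, ContinuousMap.coe_mk,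
        Function.mem_support] at hx ⊢
      intro h
      simp [h] at hx
    · refine subset_trans (closure_mono fun x hx => ?_) (hηs i)
      simp only [CompactlySupportedContinuousMap.coe_mk, ContinuousMap.coe_mk,
        Function.mem_support] at hx ⊢
      intro h
      simp [h] at hx
  · intro i e
    simp only [CompactlySupportedContinuousMap.coe_mk, ContinuousMap.coe_mk]
    by_cases he : χ i e = 0
    · simp [he]
    · rw [hη1 i (subset_tsupport _ he)]
      simp

lemma continuous_fiberSumFun_of_chart (g : C_c(W, ℂ)) (φ : OpenPartialHomeomorph W V)
    (hφ : E.s = φ) (hg : tsupport g ⊆ φ.source) : Continuous (E.fiberSumFun g) := by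
  have hK : IsClosed (E.s '' tsupport g) :=
    (IsCompact.image g.hasCompactSupport E.continuous_s).isClosed
  have h1 : ∀ v ∈ φ.target, E.fiberSumFun g v = g (φ.symm v) := by
    intro v hv
    have hs : E.s (φ.symm v) = v := by rw [hφ]; exact φ.right_inv hv
    unfold fiberSumFun
    rw [finsum_eq_single _ ⟨φ.symm v, hs⟩]
    intro e he
    by_contra h
    have hes : (e : W) ∈ φ.source := hg (subset_tsupport _ h)
    apply he
    apply Subtype.ext
    have h2 : φ e = v := by rw [← hφ]; exact e.2
    change (e : W) = φ.symm v
    exact (φ.left_inv hes).symm.trans (congrArg φ.symm h2)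
  rw [continuous_iff_continuousAt]
  intro v
  by_cases hv : v ∈ φ.target
  · have : ContinuousAt (fun v => g (φ.symm v)) v :=
      g.continuous.continuousAt.comp (φ.continuousAt_symm hv)
    refine this.congr ?_
    filter_upwards [φ.open_target.mem_nhds hv] with w hw
    exact (h1 w hw).symm
  · have hv' : v ∈ (E.s '' tsupport g)ᶜ := by
      rintro ⟨e, he, rfl⟩
      exact hv (by rw [hφ]; exact φ.map_source (hg he))
    have : ContinuousAt (fun _ : V => (0 : ℂ)) v := continuousAt_const
    refine this.congr ?_
    filter_upwards [hK.isOpen_compl.mem_nhds hv'] with w hw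
    exact (E.fiberSumFun_eq_zero fun h => hw (Set.image_mono (subset_tsupport _) h)).symm

lemma continuous_fiberSumFun (f : C_c(W, ℂ)) : Continuous (E.fiberSumFun f) := by
  obtain ⟨n, g, η, hf, hg, -⟩ := E.exists_chart_decomposition f
  have : E.fiberSumFun f = fun v => ∑ i, E.fiberSumFun (g i) v := by
    ext v
    rw [← fiberSumFun_sum]
    congr 1
    ext e
    exact hf e
  rw [this]
  refine continuous_finsetSum _ fun i _ => ?_
  obtain ⟨φ, h1, h2, -⟩ := hg i
  exact E.continuous_fiberSumFun_of_chart (g i) φ h1 h2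

/-- The continuous function `v ↦ ∑_{s(e) = v} f(e)` (of compact support, so vanishing at infinity)
for `f ∈ C_c(E¹)`. -/
def fiberSum (f : C_c(W, ℂ)) : C₀(V, ℂ) where
  toFun := E.fiberSumFun f
  continuous_toFun := E.continuous_fiberSumFun f
  zero_at_infty' := by
    have hK : IsCompact (E.s '' tsupport f) :=
      IsCompact.image f.hasCompactSupport E.continuous_s
    refine HasCompactSupport.is_zero_at_infty ?_
    exact HasCompactSupport.intro hK fun v hv =>
      E.fiberSumFun_eq_zero fun h => hv (Set.image_mono (subset_tsupport _) h)

lemma fiberSum_apply (f : C_c(W, ℂ)) (v : V) :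
    E.fiberSum f v = ∑ᶠ e : {e : W // E.s e = v}, f e := rfl

lemma fiberSum_add (f g : C_c(W, ℂ)) : E.fiberSum (f + g) = E.fiberSum f + E.fiberSum g := by
  ext v
  simp only [fiberSum_apply, CompactlySupportedContinuousMap.add_apply, ZeroAtInftyContinuousMap.add_apply]
  exact finsum_add_distrib (E.finite_fiber f v) (E.finite_fiber g v)

lemma fiberSum_smul (c : ℂ) (f : C_c(W, ℂ)) : E.fiberSum (c • f) = c • E.fiberSum f := by
  ext v
  simp only [fiberSum_apply, CompactlySupportedContinuousMap.smul_apply, ZeroAtInftyContinuousMap.smul_apply]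
  exact (smul_finsum c _).symm

lemma fiberSum_star (f : C_c(W, ℂ)) : E.fiberSum (star f) = star (E.fiberSum f) := by
  ext v
  simp only [fiberSum_apply, CompactlySupportedContinuousMap.star_apply, ZeroAtInftyContinuousMap.star_apply]
  exact ((starAddEquiv : ℂ ≃+ ℂ).toAddMonoidHom.map_finsum (E.finite_fiber f v)).symm

/-- `C₀(V)` with its order as a C⋆-algebra. -/
instance instPartialOrderC0 : PartialOrder C₀(V, ℂ) := CStarAlgebra.spectralOrder _

instance instStarOrderedRingC0 : StarOrderedRing C₀(V, ℂ) := CStarAlgebra.spectralOrderedRing _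

/-- The space `C_c(E¹)`, to be equipped with its `C₀(E⁰)`-valued inner product. -/
def PreModule (_E : TopologicalGraph V W) : Type v := C_c(W, ℂ)

namespace PreModule

instance : AddCommGroup (PreModule E) := inferInstanceAs (AddCommGroup C_c(W, ℂ))

instance : Module ℂ (PreModule E) := inferInstanceAs (Module ℂ C_c(W, ℂ))

variable {E}

/-- An element of the pre-Hilbert module as a compactly supported function on the edges. -/
def toFunc (ξ : PreModule E) : C_c(W, ℂ) := ξ

/-- A compactly supported function on the edges as an element of the pre-Hilbert module. -/
def ofFunc (f : C_c(W, ℂ)) : PreModule E := f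

@[simp] lemma toFunc_ofFunc (f : C_c(W, ℂ)) : (ofFunc f : PreModule E).toFunc = f := rfl

@[ext] lemma ext {ξ η : PreModule E} (h : ∀ e, ξ.toFunc e = η.toFunc e) : ξ = η :=
  CompactlySupportedContinuousMap.ext h

@[simp] lemma toFunc_add (ξ η : PreModule E) : (ξ + η).toFunc = ξ.toFunc + η.toFunc := rfl

@[simp] lemma toFunc_smul (c : ℂ) (ξ : PreModule E) : (c • ξ).toFunc = c • ξ.toFunc := rfl

/-- Pointwise multiplication of `ξ ∈ C_c(E¹)` by a continuous bounded function on `E¹`. -/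
def mulFun (g : W →ᵇ ℂ) (ξ : PreModule E) : PreModule E :=
  (⟨⟨fun e => g e * ξ.toFunc e, by fun_prop⟩,
    HasCompactSupport.mul_left (f := g) (f' := ξ.toFunc) ξ.toFunc.hasCompactSupport⟩ : C_c(W, ℂ))

@[simp] lemma toFunc_mulFun (g : W →ᵇ ℂ) (ξ : PreModule E) (e : W) :
    (mulFun g ξ).toFunc e = g e * ξ.toFunc e := rfl

end PreModule

/-- The pullback `a ↦ a ∘ p` from `C₀(E⁰)` to the bounded continuous functions
on `E¹` along a continuous map `p : E¹ → E⁰`. -/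
def pullback (p : C(W, V)) : C₀(V, ℂ) →L[ℂ] (W →ᵇ ℂ) :=
  LinearMap.mkContinuous
    { toFun := fun a => a.toBCF.compContinuous p
      map_add' := fun _ _ => rfl
      map_smul' := fun _ _ => rfl } 1 fun a => by
    rw [one_mul, BoundedContinuousFunction.norm_le (norm_nonneg _)]
    intro e
    exact (BoundedContinuousFunction.norm_coe_le_norm a.toBCF (p e)).trans
      (le_of_eq ZeroAtInftyContinuousMap.norm_toBCF_eq_norm)

@[simp] lemma pullback_apply (p : C(W, V)) (a : C₀(V, ℂ)) (e : W) : pullback p a e = a (p e) := rfl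

/-- The range map as a bundled continuous map. -/
def rMap : C(W, V) := ⟨E.r, E.continuous_r⟩

/-- The source map as a bundled continuous map. -/
def sMap : C(W, V) := ⟨E.s, E.continuous_s⟩

namespace PreModule

variable {E}

/-- The `C₀(E⁰)`-valued inner product `⟨ξ, η⟩(v) = ∑_{s(e) = v} conj (ξ e) * η e`. -/
instance instInner : Inner C₀(V, ℂ) (PreModule E) :=
  ⟨fun ξ η => E.fiberSum (star ξ.toFunc * η.toFunc)⟩

lemma inner_def (ξ η : PreModule E) :
    inner C₀(V, ℂ) ξ η = E.fiberSum (star ξ.toFunc * η.toFunc) := rfl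

/-- The right action `(ξ · a)(e) = ξ e * a (s e)` of `C₀(E⁰)`. -/
instance instSMul : SMul C₀(V, ℂ) (PreModule E) := ⟨fun a ξ => mulFun (pullback E.sMap a) ξ⟩

/-- The norm `‖ξ‖ = ‖⟨ξ, ξ⟩‖ ^ (1/2)`. -/
instance instNorm : Norm (PreModule E) := ⟨fun ξ => √‖inner C₀(V, ℂ) ξ ξ‖⟩

lemma inner_self_apply (ξ : PreModule E) (v : V) :
    inner C₀(V, ℂ) ξ ξ v = ((∑ᶠ e : {e : W // E.s e = v}, ‖ξ.toFunc e‖ ^ 2 : ℝ) : ℂ) := by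
  have h : ((∑ᶠ e : {e : W // E.s e = v}, ‖ξ.toFunc e‖ ^ 2 : ℝ) : ℂ) =
      ∑ᶠ e : {e : W // E.s e = v}, ((‖ξ.toFunc e‖ ^ 2 : ℝ) : ℂ) := by
    refine Complex.ofRealHom.toAddMonoidHom.map_finsum ?_
    refine (E.finite_fiber ξ.toFunc v).subset fun e he => ?_
    simpa using he
  rw [h, inner_def, fiberSum_apply]
  refine finsum_congr fun e => ?_
  simp only [CompactlySupportedContinuousMap.mul_apply, CompactlySupportedContinuousMap.star_apply]
  rw [Complex.star_def, ← Complex.normSq_eq_conj_mul_self, Complex.normSq_eq_norm_sq]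

lemma norm_sq_le_inner (ξ : PreModule E) (e : W) :
    ‖ξ.toFunc e‖ ^ 2 ≤ ∑ᶠ e' : {e' : W // E.s e' = E.s e}, ‖ξ.toFunc e'‖ ^ 2 := by
  have hfin : (Function.support
      fun e' : {e' : W // E.s e' = E.s e} => ‖ξ.toFunc e'‖ ^ 2).Finite := by
    refine (E.finite_fiber ξ.toFunc (E.s e)).subset fun e he => ?_
    simpa using he
  exact single_le_finsum (⟨e, rfl⟩ : {e' : W // E.s e' = E.s e}) hfin fun _ => by positivity

instance instCStarModule : CStarModule C₀(V, ℂ) (PreModule E) where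
  inner_add_right {x y z} := by
    simp only [inner_def, toFunc_add, mul_add, fiberSum_add]
  inner_self_nonneg {ξ} := by
    have hs : Continuous fun z : ℂ => (√z.re : ℂ) := by fun_prop
    let b : C₀(V, ℂ) :=
      ⟨⟨fun v => (√(inner C₀(V, ℂ) ξ ξ v).re : ℂ), by fun_prop⟩, by
        have := (hs.tendsto 0).comp (inner C₀(V, ℂ) ξ ξ).zero_at_infty'
        simpa [Function.comp_def] using this⟩
    have : inner C₀(V, ℂ) ξ ξ = star b * b := by
      ext v
      change _ = star (√(inner C₀(V, ℂ) ξ ξ v).re : ℂ) * (√(inner C₀(V, ℂ) ξ ξ v).re : ℂ)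
      rw [inner_self_apply, Complex.ofReal_re, Complex.star_def, Complex.conj_ofReal,
        ← Complex.ofReal_mul, Real.mul_self_sqrt]
      exact finsum_nonneg fun _ => by positivity
    rw [this]
    exact star_mul_self_nonneg b
  inner_self {ξ} := by
    constructor
    · intro h
      ext e
      have h1 := norm_sq_le_inner ξ e
      have h2 := inner_self_apply ξ (E.s e)
      rw [h, ZeroAtInftyContinuousMap.zero_apply, eq_comm, Complex.ofReal_eq_zero] at h2
      rw [h2] at h1
      have : ‖ξ.toFunc e‖ = 0 := by
        have := sq_nonneg ‖ξ.toFunc e‖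
        exact pow_eq_zero_iff (two_ne_zero) |>.1 (le_antisymm h1 this)
      exact norm_eq_zero.1 this
    · rintro rfl
      ext v
      rw [inner_self_apply]
      have : ∀ e : W, (0 : PreModule E).toFunc e = 0 := fun _ => rfl
      simp [this]
  inner_op_smul_right {a ξ η} := by
    ext v
    simp only [inner_def, fiberSum_apply, ZeroAtInftyContinuousMap.mul_apply]
    rw [mul_finsum]
    refine finsum_congr fun e => ?_
    have : (a • η).toFunc (e : W) = a v * η.toFunc e := by
      change a (E.s e) * η.toFunc e = _
      rw [e.2]
    simp only [CompactlySupportedContinuousMap.mul_apply, this]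
    ring
  inner_smul_right_complex {z x y} := by
    simp only [inner_def, toFunc_smul, ← fiberSum_smul]
    congr 1
    ext e
    simp [mul_left_comm]
  star_inner x y := by
    simp only [inner_def, ← fiberSum_star]
    congr 1
    ext e
    simp [mul_comm]
  norm_eq_sqrt_norm_inner_self _ := rfl

instance instNormedAddCommGroup : NormedAddCommGroup (PreModule E) :=
  NormedAddCommGroup.ofCore (CStarModule.normedSpaceCore C₀(V, ℂ))

instance instNormedSpace : NormedSpace ℂ (PreModule E) :=
  NormedSpace.ofCore (CStarModule.normedSpaceCore C₀(V, ℂ))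

lemma norm_sq (ξ : PreModule E) : ‖ξ‖ ^ 2 = ‖inner C₀(V, ℂ) ξ ξ‖ :=
  Real.sq_sqrt (norm_nonneg _)

lemma norm_mulFun_le (g : W →ᵇ ℂ) (ξ : PreModule E) : ‖mulFun g ξ‖ ≤ ‖g‖ * ‖ξ‖ := by
  have h : ‖mulFun g ξ‖ ^ 2 ≤ (‖g‖ * ‖ξ‖) ^ 2 := by
    rw [mul_pow, norm_sq, norm_sq, ← ZeroAtInftyContinuousMap.norm_toBCF_eq_norm,
      BoundedContinuousFunction.norm_le (by positivity)]
    intro v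
    change ‖inner C₀(V, ℂ) (mulFun g ξ) (mulFun g ξ) v‖ ≤ _
    have hfin : ∀ ξ : PreModule E, (Function.support
        fun e' : {e' : W // E.s e' = v} => ‖ξ.toFunc e'‖ ^ 2).Finite := by
      intro ξ
      refine (E.finite_fiber ξ.toFunc v).subset fun e he => ?_
      simpa using he
    have h0 : ∀ ξ : PreModule E, 0 ≤ ∑ᶠ e : {e : W // E.s e = v}, ‖ξ.toFunc e‖ ^ 2 :=
      fun ξ => finsum_nonneg fun _ => by positivity
    calc ‖inner C₀(V, ℂ) (mulFun g ξ) (mulFun g ξ) v‖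
        = ∑ᶠ e : {e : W // E.s e = v}, ‖(mulFun g ξ).toFunc e‖ ^ 2 := by
          rw [inner_self_apply, Complex.norm_real, Real.norm_of_nonneg (h0 _)]
      _ ≤ ∑ᶠ e : {e : W // E.s e = v}, ‖g‖ ^ 2 * ‖ξ.toFunc e‖ ^ 2 := by
          refine finsum_le_finsum' (hfin _) ?_ fun e => ?_
          · refine (hfin ξ).subset fun e he => ?_
            simp only [Function.mem_support] at he ⊢
            exact right_ne_zero_of_mul he
          · simp only [toFunc_mulFun, norm_mul, mul_pow]
            gcongr
            exact g.norm_coe_le_norm _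
      _ = ‖g‖ ^ 2 * ‖inner C₀(V, ℂ) ξ ξ v‖ := by
          rw [← mul_finsum, inner_self_apply, Complex.norm_real,
            Real.norm_of_nonneg (h0 _)]
      _ ≤ ‖g‖ ^ 2 * ‖inner C₀(V, ℂ) ξ ξ‖ := by
          gcongr
          rw [← ZeroAtInftyContinuousMap.norm_toBCF_eq_norm]
          exact BoundedContinuousFunction.norm_coe_le_norm (inner C₀(V, ℂ) ξ ξ).toBCF v
  exact (pow_le_pow_iff_left₀ (norm_nonneg _) (by positivity) two_ne_zero).1 h

variable (E) in
/-- Multiplication of functions in `C_c(E¹)` by bounded continuous functions, as a bounded bilinear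
map. -/
def mulL : (W →ᵇ ℂ) →L[ℂ] PreModule E →L[ℂ] PreModule E :=
  LinearMap.mkContinuous₂
    (LinearMap.mk₂ ℂ mulFun (fun g h ξ => by ext e; simp [add_mul])
      (fun c g ξ => by ext e; simp [mul_assoc]) (fun g ξ η => by ext e; simp [mul_add])
      (fun c g ξ => by ext e; simp [mul_left_comm])) 1
    fun g ξ => by simpa using norm_mulFun_le g ξ

@[simp] lemma mulL_apply (g : W →ᵇ ℂ) (ξ : PreModule E) : mulL E g ξ = mulFun g ξ := rfl

end PreModule

/-- The C⋆-correspondence `H(E)`: the completion of `C_c(E¹)` for its inner product. -/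
def Corr (E : TopologicalGraph V W) : Type v := UniformSpace.Completion (PreModule E)

namespace Corr

instance : NormedAddCommGroup (Corr E) :=
  inferInstanceAs (NormedAddCommGroup (UniformSpace.Completion (PreModule E)))

instance : NormedSpace ℂ (Corr E) :=
  inferInstanceAs (NormedSpace ℂ (UniformSpace.Completion (PreModule E)))

instance : CompleteSpace (Corr E) :=
  inferInstanceAs (CompleteSpace (UniformSpace.Completion (PreModule E)))

/-- The canonical map `C_c(E¹) → H(E)`. -/
def ofPre : PreModule E →L[ℂ] Corr E :=
  (UniformSpace.Completion.toComplL : PreModule E →L[ℂ] UniformSpace.Completion (PreModule E))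

lemma denseRange_ofPre : DenseRange (ofPre E) := UniformSpace.Completion.denseRange_coe

lemma isUniformInducing_ofPre : IsUniformInducing (ofPre E) :=
  (UniformSpace.Completion.toComplₗᵢ (𝕜 := ℂ) (E := PreModule E)).isometry.isUniformInducing

/-- The `C₀(E⁰)`-valued inner product on `H(E)`, conjugate linear in the first variable and linear
in the second: the continuous extension of the inner product on `C_c(E¹)`. -/
def innerL : Corr E →L⋆[ℂ] Corr E →L[ℂ] C₀(V, ℂ) :=
  (((CStarModule.innerSL (A := C₀(V, ℂ)) (E := PreModule E)).extend (ofPre E)).flip.extend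
    (ofPre E)).flip

/-- The action of bounded continuous functions on `H(E)` which extends pointwise multiplication on
`C_c(E¹)`. -/
def mulOp : (W →ᵇ ℂ) →L[ℂ] Corr E →L[ℂ] Corr E :=
  (((ContinuousLinearMap.compL ℂ (PreModule E) (PreModule E) (Corr E) (ofPre E)).comp
    (PreModule.mulL E)).flip.extend (ofPre E)).flip

@[simp] lemma innerL_ofPre (ξ η : PreModule E) :
    innerL E (ofPre E ξ) (ofPre E η) = inner C₀(V, ℂ) ξ η := by
  simp only [innerL, ContinuousLinearMap.flip_apply]
  rw [ContinuousLinearMap.extend_eq _ (denseRange_ofPre E) (isUniformInducing_ofPre E),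
    ContinuousLinearMap.flip_apply,
    ContinuousLinearMap.extend_eq _ (denseRange_ofPre E) (isUniformInducing_ofPre E)]
  rfl

@[simp] lemma mulOp_ofPre (g : W →ᵇ ℂ) (ξ : PreModule E) :
    mulOp E g (ofPre E ξ) = ofPre E (PreModule.mulFun g ξ) := by
  simp only [mulOp, ContinuousLinearMap.flip_apply]
  rw [ContinuousLinearMap.extend_eq _ (denseRange_ofPre E) (isUniformInducing_ofPre E)]
  rfl

/-- The left action `a · ξ = (a ∘ r) ξ` of `a ∈ C₀(E⁰)`, as an operator on `H(E)`. -/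
def leftAct (a : C₀(V, ℂ)) : Corr E →L[ℂ] Corr E := mulOp E (pullback E.rMap a)

/-- The right action `ξ · a = ξ (a ∘ s)` of `C₀(E⁰)` on `H(E)`. -/
def rightAct (ξ : Corr E) : C₀(V, ℂ) →L[ℂ] Corr E := (mulOp E).flip ξ ∘L pullback E.sMap

/-- The rank one operator `ξ ⊗ η⋆ : ζ ↦ ξ · ⟨η, ζ⟩` on `H(E)`. -/
def rankOne (ξ η : Corr E) : Corr E →L[ℂ] Corr E := rightAct E ξ ∘L innerL E η

/-- The compact operators on `H(E)`: the closed linear span of the rank one operators. -/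
def compacts : Submodule ℂ (Corr E →L[ℂ] Corr E) :=
  (Submodule.span ℂ (Set.range fun p : Corr E × Corr E => rankOne E p.1 p.2)).topologicalClosure

lemma rankOne_mem (ξ η : Corr E) : rankOne E ξ η ∈ compacts E :=
  Submodule.le_topologicalClosure _ (Submodule.subset_span ⟨(ξ, η), rfl⟩)

lemma star_innerL (ξ η : Corr E) : star (innerL E ξ η) = innerL E η ξ := by
  refine (denseRange_ofPre E).induction_on₂ (p := fun ξ η => star (innerL E ξ η) = innerL E η ξ)
    ?_ (fun a b => ?_) ξ η
  · exact isClosed_eq (by fun_prop) (by fun_prop)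
  · rw [innerL_ofPre, innerL_ofPre]
    exact PreModule.instCStarModule.star_inner a b

lemma norm_innerL_self (ξ : Corr E) : ‖innerL E ξ ξ‖ = ‖ξ‖ ^ 2 := by
  refine (denseRange_ofPre E).induction_on (p := fun ξ => ‖innerL E ξ ξ‖ = ‖ξ‖ ^ 2)
    ξ ?_ (fun a => ?_)
  · exact isClosed_eq (by fun_prop) (by fun_prop)
  · rw [innerL_ofPre, ← PreModule.norm_sq]
    congr 1
    exact (UniformSpace.Completion.norm_coe a).symm

lemma norm_innerL_le (ξ η : Corr E) : ‖innerL E ξ η‖ ≤ ‖ξ‖ * ‖η‖ := by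
  refine (denseRange_ofPre E).induction_on₂ (p := fun ξ η => ‖innerL E ξ η‖ ≤ ‖ξ‖ * ‖η‖)
    ?_ (fun a b => ?_) ξ η
  · exact isClosed_le (by fun_prop) (by fun_prop)
  · rw [innerL_ofPre]
    refine (CStarModule.norm_inner_le (A := C₀(V, ℂ)) (PreModule E)).trans (le_of_eq ?_)
    congr 1 <;> exact (UniformSpace.Completion.norm_coe _).symm

lemma rightAct_ofPre (ξ : PreModule E) (a : C₀(V, ℂ)) :
    rightAct E (ofPre E ξ) a = ofPre E (a • ξ) := by
  simp only [rightAct, ContinuousLinearMap.comp_apply, ContinuousLinearMap.flip_apply, mulOp_ofPre]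
  rfl

lemma innerL_rightAct (ξ η : Corr E) (a : C₀(V, ℂ)) :
    innerL E ξ (rightAct E η a) = innerL E ξ η * a := by
  refine (denseRange_ofPre E).induction_on₂
    (p := fun ξ η => innerL E ξ (rightAct E η a) = innerL E ξ η * a) ?_ (fun ξ η => ?_) ξ η
  · refine isClosed_eq ?_ (by fun_prop)
    simp only [rightAct, ContinuousLinearMap.comp_apply, ContinuousLinearMap.flip_apply]
    fun_prop
  · rw [rightAct_ofPre, innerL_ofPre, innerL_ofPre, mul_comm]
    exact PreModule.instCStarModule.inner_op_smul_right

end Corr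

lemma isCompact_preimage_r {K : Set V} (hK : IsCompact K) (hKr : K ⊆ E.regular) :
    IsCompact (E.r ⁻¹' K) := by
  have h : ∀ x ∈ K, ∃ N : Set V, x ∈ interior N ∧ IsCompact (E.r ⁻¹' N) := by
    intro x hx
    obtain ⟨U, ⟨hU, hprop, -⟩, hxU⟩ := hKr hx
    obtain ⟨N, hN, hxN, hNU⟩ := exists_compact_subset hU hxU
    refine ⟨N, hxN, ?_⟩
    have h1 : IsCompact ((Subtype.val : U → V) ⁻¹' N) := by
      rw [Topology.IsInducing.subtypeVal.isCompact_iff, Subtype.image_preimage_coe,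
        Set.inter_eq_right.2 hNU]
      exact hN
    have h2 := (hprop.isCompact_preimage h1).image continuous_subtype_val
    convert h2 using 1
    ext e
    constructor
    · intro he
      exact ⟨⟨e, hNU he⟩, he, rfl⟩
    · rintro ⟨y, hy, rfl⟩
      exact hy
  choose! N hN1 hN2 using h
  obtain ⟨t, htK, ht⟩ := hK.elim_nhds_subcover N
    (fun x hx => mem_interior_iff_mem_nhds.1 (hN1 x hx))
  have hc : IsCompact (⋃ x ∈ t, E.r ⁻¹' N x) := t.isCompact_biUnion fun x hx => hN2 x (htK x hx)
  refine hc.of_isClosed_subset (hK.isClosed.preimage E.continuous_r) ?_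
  intro e he
  have := ht he
  simpa using this

namespace Corr

lemma mulOp_mem_compacts_of_hasCompactSupport (g : W →ᵇ ℂ) (hg : HasCompactSupport g) :
    mulOp E g ∈ compacts E := by
  obtain ⟨n, f, η, hf, hφ, hfη⟩ :=
    E.exists_chart_decomposition (⟨⟨g, g.continuous⟩, hg⟩ : C_c(W, ℂ))
  have key : mulOp E g = ∑ i, rankOne E (ofPre E (PreModule.ofFunc (f i)))
      (ofPre E (PreModule.ofFunc (star (η i)))) := by
    ext ζ
    refine (denseRange_ofPre E).induction_on ζ (isClosed_eq (by fun_prop) (by fun_prop)) ?_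
    intro ζ
    rw [mulOp_ofPre, _root_.sum_apply]
    simp only [rankOne, ContinuousLinearMap.comp_apply]
    have h1 : ∀ i, rightAct E (ofPre E (PreModule.ofFunc (f i)))
        (innerL E (ofPre E (PreModule.ofFunc (star (η i)))) (ofPre E ζ)) =
        ofPre E (inner C₀(V, ℂ) (PreModule.ofFunc (star (η i))) ζ • PreModule.ofFunc (f i) : PreModule E) := by
      intro i
      rw [innerL_ofPre, rightAct_ofPre]
    simp only [h1]
    rw [← map_sum]
    congr 1
    apply PreModule.ext
    intro e
    have h2 : (∑ i, (inner C₀(V, ℂ) (PreModule.ofFunc (star (η i))) ζ • PreModule.ofFunc (f i) :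
        PreModule E)).toFunc e = ∑ i, f i e * ζ.toFunc e := by
      have h3 : ∀ ξ : Fin n → PreModule E, (∑ i, ξ i).toFunc e = ∑ i, (ξ i).toFunc e :=
        fun ξ => CompactlySupportedContinuousMap.sum_apply Finset.univ
          (fun i => (ξ i).toFunc) e
      rw [h3]
      refine Finset.sum_congr rfl fun i _ => ?_
      change E.fiberSum (star (star (η i)) * ζ.toFunc) (E.s e) * f i e = _
      by_cases hfe : f i e = 0
      · simp [hfe]
      obtain ⟨φ, hs, hfs, hηs⟩ := hφ i
      have hes : e ∈ φ.source := hfs (subset_tsupport _ hfe)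
      have hη1 : η i e = 1 := by
        have := hfη i e
        exact mul_left_cancel₀ hfe (by rw [this, mul_one])
      rw [fiberSum_apply, finsum_eq_single _ (⟨e, rfl⟩ : {e' : W // E.s e' = E.s e})]
      · simp [hη1, mul_comm]
      · intro e' he'
        simp only [star_star, CompactlySupportedContinuousMap.mul_apply]
        by_cases h0 : η i e' = 0
        · simp [h0]
        · exfalso
          apply he'
          apply Subtype.ext
          have h5 : (e' : W) ∈ φ.source := hηs (subset_tsupport _ h0)
          have h6 := e'.2
          exact φ.injOn h5 hes ((congrFun hs _).symm.trans (h6.trans (congrFun hs e)))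
    rw [h2, PreModule.toFunc_mulFun, ← Finset.sum_mul, ← hf e]
    rfl
  rw [key]
  exact Submodule.sum_mem _ fun i _ => rankOne_mem E _ _

/-- The left action of a function in `C₀(E⁰_reg)` on `H(E)` is by compact operators. -/
lemma leftAct_mem_compacts (a : C₀(V, ℂ)) (ha : ∀ v ∉ E.regular, a v = 0) :
    leftAct E a ∈ compacts E := by
  have hcl : IsClosed (compacts E : Set (Corr E →L[ℂ] Corr E)) :=
    Submodule.isClosed_topologicalClosure _
  suffices h : pullback E.rMap a ∈ closure ((mulOp E) ⁻¹' (compacts E)) by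
    rwa [(hcl.preimage (mulOp E).continuous).closure_eq] at h
  rw [Metric.mem_closure_iff]
  intro ε hε
  have hK : IsCompact {v | ε / 2 ≤ ‖a v‖} := by
    have h1 := (Metric.tendsto_nhds.1 a.zero_at_infty') (ε / 2) (by positivity)
    rw [Filter.eventually_iff, Filter.mem_cocompact] at h1
    obtain ⟨t, ht, hta⟩ := h1
    refine ht.of_isClosed_subset (isClosed_le continuous_const (by fun_prop)) ?_
    intro v hv
    by_contra hvt
    have := hta hvt
    simp only [Set.mem_ofPred_eq, dist_zero_right] at this hv
    exact absurd this (not_lt.2 hv)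
  have hKr : {v | ε / 2 ≤ ‖a v‖} ⊆ E.regular := by
    intro v hv
    by_contra h
    rw [Set.mem_ofPred_eq, ha v h, norm_zero] at hv
    linarith
  obtain ⟨χ, hχ1, -, hχc, hχ01⟩ := exists_continuous_one_zero_of_isCompact
    (E.isCompact_preimage_r hK hKr) isClosed_empty (Set.disjoint_empty _)
  let χb : W →ᵇ ℂ := BoundedContinuousFunction.ofNormedAddCommGroup (fun e => (χ e : ℂ))
    (by fun_prop) 1 fun e => by
      rw [Complex.norm_real, Real.norm_of_nonneg (hχ01 e).1]
      exact (hχ01 e).2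
  refine ⟨χb * pullback E.rMap a, ?_, ?_⟩
  · refine mulOp_mem_compacts_of_hasCompactSupport E _ ?_
    refine HasCompactSupport.mul_right (f := fun e => (χ e : ℂ)) (f' := pullback E.rMap a) ?_
    exact hχc.comp_left (g := fun x : ℝ => (x : ℂ)) (by simp)
  · rw [dist_eq_norm]
    refine lt_of_le_of_lt (b := ε / 2) ?_ (by linarith)
    rw [BoundedContinuousFunction.norm_le (by positivity)]
    intro e
    change ‖a (E.r e) - (χ e : ℂ) * a (E.r e)‖ ≤ _
    by_cases he : ε / 2 ≤ ‖a (E.r e)‖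
    · rw [hχ1 (show e ∈ E.r ⁻¹' {v | ε / 2 ≤ ‖a v‖} from he)]
      simp
      positivity
    · have h1 : a (E.r e) - (χ e : ℂ) * a (E.r e) = ((1 - χ e : ℝ) : ℂ) * a (E.r e) := by
        push_cast; ring
      have h2 := hχ01 e
      rw [h1, norm_mul, Complex.norm_real, Real.norm_of_nonneg (by linarith [h2.2])]
      nlinarith [norm_nonneg (a (E.r e)), h2.1, h2.2]

end Corr

lemma star_mul_C0 (a b : C₀(V, ℂ)) : star (a * b) = star a * star b := by
  ext v
  simp

/-- A Toeplitz representation `(π⁰, π¹)` of the topological graph `E` on a C⋆-algebra `A`. -/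
structure ToeplitzRep (A : Type*) [NonUnitalCStarAlgebra A] where
  /-- The `*`-homomorphism `π⁰ : C₀(E⁰) → A`. -/
  π₀ : C₀(V, ℂ) →⋆ₙₐ[ℂ] A
  /-- The linear map `π¹ : H(E) → A`. -/
  π₁ : Corr E →ₗ[ℂ] A
  star_mul_eq : ∀ ξ η, star (π₁ ξ) * π₁ η = π₀ (Corr.innerL E ξ η)
  mul_eq : ∀ a ξ, π₀ a * π₁ ξ = π₁ (Corr.leftAct E a ξ)

instance : IsBoundedSMul ℂ (Corr.compacts E) where
  dist_smul_pair' c x y := dist_smul_pair c (x : Corr E →L[ℂ] Corr E) (y : Corr E →L[ℂ] Corr E)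
  dist_pair_smul' c d x := dist_pair_smul c d (x : Corr E →L[ℂ] Corr E)

/-- The finite sum `∑ᵢ cᵢ ξᵢ ⊗ ηᵢ⋆` of rank one operators, as a compact operator on `H(E)`. -/
def rankOneSum : (Corr E × Corr E →₀ ℂ) →ₗ[ℂ] Corr.compacts E :=
  Finsupp.linearCombination ℂ fun p => ⟨Corr.rankOne E p.1 p.2, Corr.rankOne_mem E p.1 p.2⟩

lemma denseRange_rankOneSum : DenseRange (rankOneSum E) := by
  intro T
  have hT : (T : Corr E →L[ℂ] Corr E) ∈ closure (Submodule.span ℂ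
      (Set.range fun p : Corr E × Corr E => Corr.rankOne E p.1 p.2) : Set _) := T.2
  rw [closure_subtype]
  refine closure_mono ?_ hT
  intro S hS
  rw [SetLike.mem_coe, Finsupp.mem_span_range_iff_exists_finsupp] at hS
  obtain ⟨c, hc⟩ := hS
  refine ⟨rankOneSum E c, ⟨c, rfl⟩, ?_⟩
  rw [← hc, rankOneSum, Finsupp.linearCombination_apply, Finsupp.sum, Finsupp.sum]
  simp

namespace ToeplitzRep

variable {E} {A : Type*} [NonUnitalCStarAlgebra A] (ρ : ToeplitzRep E A)

lemma norm_π₁_le (ξ : Corr E) : ‖ρ.π₁ ξ‖ ≤ ‖ξ‖ := by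
  have h : ‖ρ.π₁ ξ‖ ^ 2 ≤ ‖ξ‖ ^ 2 := by
    rw [sq, ← CStarRing.norm_star_mul_self, ρ.star_mul_eq, ← Corr.norm_innerL_self]
    exact NonUnitalStarAlgHom.norm_apply_le ρ.π₀ _
  exact (pow_le_pow_iff_left₀ (norm_nonneg _) (norm_nonneg _) two_ne_zero).1 h

lemma π₁_mul_π₀ (ξ : Corr E) (a : C₀(V, ℂ)) :
    ρ.π₁ ξ * ρ.π₀ a = ρ.π₁ (Corr.rightAct E ξ a) := by
  have h2 : ∀ η, Corr.innerL E (Corr.rightAct E ξ a) η = star a * Corr.innerL E ξ η := by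
    intro η
    rw [← Corr.star_innerL, Corr.innerL_rightAct, star_mul_C0, Corr.star_innerL, mul_comm]
  rw [← sub_eq_zero, ← CStarRing.star_mul_self_eq_zero_iff]
  simp only [star_sub, star_mul, sub_mul, mul_sub]
  have e1 : star (ρ.π₀ a) * star (ρ.π₁ ξ) * (ρ.π₁ ξ * ρ.π₀ a) =
      ρ.π₀ (star a * Corr.innerL E ξ ξ * a) := by
    rw [map_mul, map_mul, ← ρ.star_mul_eq, map_star]
    simp only [mul_assoc]
  have e2 : star (ρ.π₀ a) * star (ρ.π₁ ξ) * ρ.π₁ (Corr.rightAct E ξ a) =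
      ρ.π₀ (star a * Corr.innerL E ξ ξ * a) := by
    rw [mul_assoc, ρ.star_mul_eq, Corr.innerL_rightAct, map_mul, map_mul, map_mul, map_star]
    simp only [mul_assoc]
  have e3 : star (ρ.π₁ (Corr.rightAct E ξ a)) * (ρ.π₁ ξ * ρ.π₀ a) =
      ρ.π₀ (star a * Corr.innerL E ξ ξ * a) := by
    rw [← mul_assoc, ρ.star_mul_eq, h2, ← map_mul]
  have e4 : star (ρ.π₁ (Corr.rightAct E ξ a)) * ρ.π₁ (Corr.rightAct E ξ a) =
      ρ.π₀ (star a * Corr.innerL E ξ ξ * a) := by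
    rw [ρ.star_mul_eq, Corr.innerL_rightAct, h2]
  rw [e1, e2, e3, e4]
  simp

lemma π₁_rankOne (ξ η ζ : Corr E) :
    ρ.π₁ ξ * star (ρ.π₁ η) * ρ.π₁ ζ = ρ.π₁ (Corr.rankOne E ξ η ζ) := by
  rw [mul_assoc, ρ.star_mul_eq, π₁_mul_π₀]
  rfl

/-- The finite sum `∑ᵢ cᵢ π¹(ξᵢ) π¹(ηᵢ)⋆`. -/
def compactSum : (Corr E × Corr E →₀ ℂ) →ₗ[ℂ] A :=
  Finsupp.linearCombination ℂ fun p => ρ.π₁ p.1 * star (ρ.π₁ p.2)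

lemma compactSum_mul (c : Corr E × Corr E →₀ ℂ) (ζ : Corr E) :
    ρ.compactSum c * ρ.π₁ ζ = ρ.π₁ ((rankOneSum E c : Corr E →L[ℂ] Corr E) ζ) := by
  induction c using Finsupp.induction_linear with
  | zero => simp
  | add f g hf hg => simp [add_mul, hf, hg]
  | single p z => simp [compactSum, rankOneSum, smul_mul_assoc, ρ.π₁_rankOne]

lemma exists_adjoint (c : Corr E × Corr E →₀ ℂ) :
    ∃ t : Corr E →L[ℂ] Corr E, (∀ ζ, star (ρ.compactSum c) * ρ.π₁ ζ = ρ.π₁ (t ζ)) ∧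
      ∀ ζ ω, Corr.innerL E (t ζ) ω =
        Corr.innerL E ζ ((rankOneSum E c : Corr E →L[ℂ] Corr E) ω) := by
  induction c using Finsupp.induction_linear with
  | zero => exact ⟨0, by simp, by simp⟩
  | add f g hf hg =>
    obtain ⟨t₁, h₁, h₁'⟩ := hf
    obtain ⟨t₂, h₂, h₂'⟩ := hg
    exact ⟨t₁ + t₂, by simp [add_mul, h₁, h₂], by simp [h₁', h₂']⟩
  | single p z =>
    refine ⟨star z • Corr.rankOne E p.2 p.1, fun ζ => ?_, fun ζ ω => ?_⟩
    · simp [compactSum, smul_mul_assoc, ← ρ.π₁_rankOne]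
    · have e1 : Corr.innerL E (Corr.rankOne E p.2 p.1 ζ) ω =
          Corr.innerL E ζ (Corr.rankOne E p.1 p.2 ω) := by
        simp only [Corr.rankOne, ContinuousLinearMap.comp_apply]
        rw [← Corr.star_innerL, Corr.innerL_rightAct, Corr.innerL_rightAct, star_mul_C0,
          Corr.star_innerL, Corr.star_innerL, mul_comm]
      simp [rankOneSum, e1]

lemma exists_bound (c : Corr E × Corr E →₀ ℂ) :
    ∃ K : ℝ, 0 ≤ K ∧ ∀ (X : Unitization ℂ A) (M : ℝ), 0 ≤ M →
      (∀ ζ, ‖X * (ρ.π₁ ζ : Unitization ℂ A)‖ ≤ M * ‖ζ‖) →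
      ‖X * (ρ.compactSum c : Unitization ℂ A)‖ ≤ M * K := by
  induction c using Finsupp.induction_linear with
  | zero => exact ⟨0, le_rfl, by simp⟩
  | add f g hf hg =>
    obtain ⟨K₁, h₁, h₁'⟩ := hf
    obtain ⟨K₂, h₂, h₂'⟩ := hg
    refine ⟨K₁ + K₂, add_nonneg h₁ h₂, fun X M hM hX => ?_⟩
    rw [map_add, Unitization.inr_add, mul_add, mul_add]
    exact (norm_add_le _ _).trans (add_le_add (h₁' X M hM hX) (h₂' X M hM hX))
  | single p z =>
    refine ⟨‖z‖ * (‖p.1‖ * ‖p.2‖), by positivity, fun X M hM hX => ?_⟩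
    have : X * (ρ.compactSum (Finsupp.single p z) : Unitization ℂ A) =
        z • (X * (ρ.π₁ p.1 : Unitization ℂ A) * (star (ρ.π₁ p.2) : A)) := by
      simp [compactSum, Unitization.inr_smul, Unitization.inr_mul, mul_assoc]
    rw [this, norm_smul]
    calc ‖z‖ * ‖X * (ρ.π₁ p.1 : Unitization ℂ A) * (star (ρ.π₁ p.2) : A)‖
        ≤ ‖z‖ * ((M * ‖p.1‖) * ‖p.2‖) := by
          gcongr
          refine (norm_mul_le _ _).trans ?_
          gcongr
          · exact hX _
          · rw [Unitization.norm_inr, norm_star]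
            exact ρ.norm_π₁_le _
      _ = M * (‖z‖ * (‖p.1‖ * ‖p.2‖)) := by ring

lemma norm_compactSum_le (c : Corr E × Corr E →₀ ℂ) :
    ‖ρ.compactSum c‖ ≤ ‖rankOneSum E c‖ := by
  obtain ⟨t, ht, ht'⟩ := ρ.exists_adjoint c
  obtain ⟨K, hK, hKX⟩ := ρ.exists_bound c
  set T := ρ.compactSum c with hT
  set u : Corr E →L[ℂ] Corr E := (rankOneSum E c : Corr E →L[ℂ] Corr E) with hu
  have htu : ‖t‖ ≤ ‖u‖ := by
    refine t.opNorm_le_bound (norm_nonneg _) fun ζ => ?_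
    have h1 : ‖t ζ‖ ^ 2 ≤ ‖ζ‖ * (‖u‖ * ‖t ζ‖) := by
      rw [← Corr.norm_innerL_self, ht']
      refine (Corr.norm_innerL_le E _ _).trans ?_
      gcongr
      exact u.le_opNorm _
    by_cases h0 : ‖t ζ‖ = 0
    · rw [h0]; positivity
    · have : 0 < ‖t ζ‖ := lt_of_le_of_ne (norm_nonneg _) (Ne.symm h0)
      nlinarith
  set S : Unitization ℂ A := ((star T * T : A) : Unitization ℂ A) with hS
  have hSsa : IsSelfAdjoint S := by
    rw [hS, Unitization.isSelfAdjoint_inr]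
    exact IsSelfAdjoint.star_mul_self T
  set N := ‖u‖ ^ 2 with hN
  have hpow : ∀ n ζ, ‖S ^ n * (ρ.π₁ ζ : Unitization ℂ A)‖ ≤ N ^ n * ‖ζ‖ := by
    intro n
    induction n with
    | zero =>
      intro ζ
      simpa [Unitization.norm_inr] using ρ.norm_π₁_le ζ
    | succ n ih =>
      intro ζ
      have h1 : S * (ρ.π₁ ζ : Unitization ℂ A) = (ρ.π₁ (t (u ζ)) : Unitization ℂ A) := by
        rw [hS, ← Unitization.inr_mul, mul_assoc, ρ.compactSum_mul, ht]
      rw [pow_succ, mul_assoc, h1]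
      refine (ih _).trans ?_
      rw [pow_succ, mul_assoc]
      gcongr
      calc ‖t (u ζ)‖ ≤ ‖t‖ * (‖u‖ * ‖ζ‖) := t.le_opNorm_of_le (u.le_opNorm _)
        _ ≤ ‖u‖ * (‖u‖ * ‖ζ‖) := by gcongr
        _ = N * ‖ζ‖ := by rw [hN]; ring
  have hbd : ∀ n, ‖S ^ (n + 1)‖ ≤ N ^ n * (‖u‖ * K) := by
    intro n
    have h1 : S ^ (n + 1) = S ^ n * ((star T : A) : Unitization ℂ A) * (T : Unitization ℂ A) := by
      rw [pow_succ, mul_assoc, hS, Unitization.inr_mul]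
    rw [h1, ← mul_assoc]
    refine hKX _ _ (by positivity) fun ζ => ?_
    rw [mul_assoc, ← Unitization.inr_mul, ht]
    refine (hpow n _).trans ?_
    rw [mul_assoc]
    gcongr
    exact (t.le_opNorm ζ).trans (by gcongr)
  have hSN : ‖S‖ ≤ N := by
    by_contra! hlt
    have hN0 : 0 ≤ N := by positivity
    have hS0 : 0 < ‖S‖ := lt_of_le_of_lt hN0 hlt
    have hk : ∀ k : ℕ, ‖S‖ ^ (2 ^ k) ≤ N ^ (2 ^ k - 1) * (‖u‖ * K) := by
      intro k
      have h1 := hbd (2 ^ k - 1)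
      have h2 : 2 ^ k - 1 + 1 = 2 ^ k := Nat.sub_add_cancel Nat.one_le_two_pow
      rw [h2] at h1
      have h3 := hSsa.nnnorm_pow_two_pow k
      have h4 : ‖S ^ (2 ^ k)‖ = ‖S‖ ^ (2 ^ k) := by simpa using congrArg NNReal.toReal h3
      rwa [h4] at h1
    rcases hN0.eq_or_lt with h0 | h0
    · have h1 := hk 1
      rw [← h0] at h1
      norm_num at h1
      rw [h1, norm_zero] at hS0
      exact lt_irrefl _ hS0
    · have hq : 1 < ‖S‖ / N := (one_lt_div h0).2 hlt
      obtain ⟨n, hn⟩ := pow_unbounded_of_one_lt (‖u‖ * K / ‖S‖) hq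
      have h1 := hk n
      have h2 : n ≤ 2 ^ n - 1 := Nat.le_sub_one_of_lt Nat.lt_two_pow_self
      have h3 : ‖u‖ * K / ‖S‖ < (‖S‖ / N) ^ (2 ^ n - 1) :=
        hn.trans_le (pow_le_pow_right₀ hq.le h2)
      rw [div_pow, div_lt_div_iff₀ hS0 (by positivity), ← pow_succ,
        Nat.sub_add_cancel Nat.one_le_two_pow] at h3
      linarith
  have hST : ‖S‖ = ‖T‖ ^ 2 := by
    rw [hS, Unitization.norm_inr, CStarRing.norm_star_mul_self, sq]
  rw [hST, hN] at hSN
  exact (pow_le_pow_iff_left₀ (norm_nonneg _) (norm_nonneg _) two_ne_zero).1 hSN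

/-- The map `φ : 𝕂(H(E)) → A` induced by a Toeplitz representation, determined by
`φ(ξ ⊗ η⋆) = π¹(ξ) π¹(η)⋆`. -/
def compactMap : Corr.compacts E →L[ℂ] A :=
  LinearMap.extendOfNorm ρ.compactSum (rankOneSum E)

lemma compactMap_rankOneSum (c : Corr E × Corr E →₀ ℂ) :
    ρ.compactMap (rankOneSum E c) = ρ.compactSum c :=
  LinearMap.extendOfNorm_eq (denseRange_rankOneSum E)
    ⟨1, fun c => by simpa using ρ.norm_compactSum_le c⟩ c

lemma compactMap_rankOne (ξ η : Corr E) :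
    ρ.compactMap ⟨Corr.rankOne E ξ η, Corr.rankOne_mem E ξ η⟩ = ρ.π₁ ξ * star (ρ.π₁ η) := by
  simpa [rankOneSum, compactSum] using ρ.compactMap_rankOneSum (Finsupp.single (ξ, η) 1)

lemma compactMap_unique (ψ : Corr.compacts E →L[ℂ] A)
    (h : ∀ ξ η, ψ ⟨Corr.rankOne E ξ η, Corr.rankOne_mem E ξ η⟩ = ρ.π₁ ξ * star (ρ.π₁ η)) :
    ψ = ρ.compactMap := by
  ext T
  refine (denseRange_rankOneSum E).induction_on T
    (isClosed_eq ψ.continuous ρ.compactMap.continuous) fun c => ?_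
  rw [ρ.compactMap_rankOneSum]
  simp only [rankOneSum, compactSum, Finsupp.linearCombination_apply, Finsupp.sum, map_sum,
    map_smul, h]

/-- Covariance: `φ(λ(a ∘ r)) = π⁰(a)` for all `a ∈ C₀(E⁰_reg)`, that is, for all `a ∈ C₀(E⁰)` which
vanish outside the open set `E⁰_reg`. -/
def IsCovariant : Prop :=
  ∀ (a : C₀(V, ℂ)) (ha : ∀ v ∉ E.regular, a v = 0),
    ρ.compactMap ⟨Corr.leftAct E a, Corr.leftAct_mem_compacts E a ha⟩ = ρ.π₀ a

end ToeplitzRep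

namespace ToeplitzRep

variable {E} {A B : Type*} [NonUnitalCStarAlgebra A] [NonUnitalCStarAlgebra B]

/-- The composition of a Toeplitz representation with a `*`-homomorphism. -/
def map (ρ : ToeplitzRep E A) (ψ : A →⋆ₙₐ[ℂ] B) : ToeplitzRep E B where
  π₀ := ψ.comp ρ.π₀
  π₁ := (ψ : A →ₗ[ℂ] B) ∘ₗ ρ.π₁
  star_mul_eq ξ η := by
    change star (ψ (ρ.π₁ ξ)) * ψ (ρ.π₁ η) = ψ (ρ.π₀ _)
    rw [← map_star, ← map_mul, ρ.star_mul_eq]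
  mul_eq a ξ := by
    change ψ (ρ.π₀ a) * ψ (ρ.π₁ ξ) = ψ (ρ.π₁ _)
    rw [← map_mul, ρ.mul_eq]

lemma compactMap_map (ρ : ToeplitzRep E A) (ψ : A →⋆ₙₐ[ℂ] B) (T : Corr.compacts E) :
    (ρ.map ψ).compactMap T = ψ (ρ.compactMap T) := by
  have hψ : Continuous ψ :=
    AddMonoidHomClass.continuous_of_bound ψ 1 fun a => by
      simpa using NonUnitalStarAlgHom.norm_apply_le ψ a
  let Ψ : A →L[ℂ] B := ⟨(ψ : A →ₗ[ℂ] B), hψ⟩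
  have := (ρ.map ψ).compactMap_unique (Ψ ∘L ρ.compactMap) fun ξ η => by
    rw [ContinuousLinearMap.comp_apply, ρ.compactMap_rankOne]
    change ψ _ = ψ (ρ.π₁ ξ) * star (ψ (ρ.π₁ η))
    rw [map_mul, map_star]
  rw [← this]
  rfl

/-- The Toeplitz representation `(π⁰, z π¹)` for `z` in the unit circle. -/
def twist (ρ : ToeplitzRep E A) (z : Circle) : ToeplitzRep E A where
  π₀ := ρ.π₀
  π₁ := (z : ℂ) • ρ.π₁
  star_mul_eq ξ η := by
    have hz : star (z : ℂ) * (z : ℂ) = 1 := by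
      rw [Complex.star_def, ← Complex.normSq_eq_conj_mul_self, Circle.normSq_coe, Complex.ofReal_one]
    rw [LinearMap.smul_apply, LinearMap.smul_apply, star_smul, smul_mul_smul_comm, hz, one_smul,
      ρ.star_mul_eq]
  mul_eq a ξ := by
    rw [LinearMap.smul_apply, LinearMap.smul_apply, mul_smul_comm, ρ.mul_eq]

lemma twist_isCovariant {ρ : ToeplitzRep E A} (hρ : ρ.IsCovariant) (z : Circle) :
    (ρ.twist z).IsCovariant := by
  have h : ρ.compactMap = (ρ.twist z).compactMap := by
    refine (ρ.twist z).compactMap_unique _ fun ξ η => ?_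
    have hz : (z : ℂ) * star (z : ℂ) = 1 := by
      rw [mul_comm, Complex.star_def, ← Complex.normSq_eq_conj_mul_self, Circle.normSq_coe,
        Complex.ofReal_one]
    rw [ρ.compactMap_rankOne]
    change _ = ((z : ℂ) • ρ.π₁ ξ) * star ((z : ℂ) • ρ.π₁ η)
    rw [star_smul, smul_mul_smul_comm, hz, one_smul]
  intro a ha
  rw [← h]
  exact hρ a ha

end ToeplitzRep

/-- A covariant representation of `E` on some C⋆-algebra in `Type (max u v)`. (Up to isomorphism this
covers all C⋆-algebras generated by a covariant representation, since such an algebra has a dense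
`*`-subalgebra generated by the images of `C₀(E⁰)` and `H(E)`.) -/
structure CovariantRep (E : TopologicalGraph V W) : Type (max u v + 1) where
  /-- The target algebra. -/
  A : Type (max u v)
  [inst : NonUnitalCStarAlgebra A]
  /-- The representation. -/
  rep : ToeplitzRep E A
  isCovariant : rep.IsCovariant

attribute [instance] CovariantRep.inst

/-- The covariant representation `(π⁰, z π¹)`. -/
def CovariantRep.twist {E : TopologicalGraph V W} (σ : CovariantRep E) (z : Circle) :
    CovariantRep E where
  A := σ.A
  rep := σ.rep.twist z
  isCovariant := ToeplitzRep.twist_isCovariant σ.isCovariant z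

/-- The C⋆-algebraic product (bounded families) of the targets of all covariant representations. -/
abbrev Ambient : Type (max u v + 1) := lp (fun σ : CovariantRep E => CovariantRep.A σ) ⊤

namespace Ambient

/-- A uniformly bounded family, as an element of the product. -/
def mk (x : ∀ σ : CovariantRep E, σ.A) (C : ℝ) (h : ∀ σ, ‖x σ‖ ≤ C) : Ambient E :=
  ⟨x, memℓp_infty ⟨C, by rintro _ ⟨σ, rfl⟩; exact h σ⟩⟩

/-- The direct product of all covariant representations. -/
def rep : ToeplitzRep E (Ambient E) where
  π₀ :=
    { toFun := fun a => mk E (fun σ => σ.rep.π₀ a) ‖a‖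
        fun σ => NonUnitalStarAlgHom.norm_apply_le σ.rep.π₀ a
      map_smul' := fun c a => by
        apply lp.ext; funext σ; exact map_smul σ.rep.π₀ c a
      map_zero' := by
        apply lp.ext; funext σ; exact map_zero σ.rep.π₀
      map_add' := fun a b => by
        apply lp.ext; funext σ; exact map_add σ.rep.π₀ a b
      map_mul' := fun a b => by
        apply lp.ext; funext σ; exact map_mul σ.rep.π₀ a b
      map_star' := fun a => by
        apply lp.ext; funext σ; exact map_star σ.rep.π₀ a }
  π₁ :=
    { toFun := fun ξ => mk E (fun σ => σ.rep.π₁ ξ) ‖ξ‖ fun σ => σ.rep.norm_π₁_le ξ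
      map_add' := fun a b => by
        apply lp.ext; funext σ; exact map_add σ.rep.π₁ a b
      map_smul' := fun c a => by
        apply lp.ext; funext σ; exact map_smul σ.rep.π₁ c a }
  star_mul_eq ξ η := by
    apply lp.ext; funext σ; exact σ.rep.star_mul_eq ξ η
  mul_eq a ξ := by
    apply lp.ext; funext σ; exact σ.rep.mul_eq a ξ

/-- The projection of the product onto one of its factors. -/
def eval (σ : CovariantRep E) : Ambient E →⋆ₙₐ[ℂ] σ.A where
  toFun x := x σ
  map_smul' _ _ := rfl
  map_zero' := rfl
  map_add' _ _ := rfl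
  map_mul' _ _ := rfl
  map_star' _ := rfl

/-- The permutation of the factors of the product induced by `(π⁰, π¹) ↦ (π⁰, z π¹)`. -/
def gauge (z : Circle) : Ambient E →⋆ₙₐ[ℂ] Ambient E where
  toFun x := mk E (fun σ => x (σ.twist z)) ‖x‖ fun _ => lp.norm_apply_le_norm ENNReal.top_ne_zero x _
  map_smul' _ _ := rfl
  map_zero' := rfl
  map_add' _ _ := rfl
  map_mul' _ _ := rfl
  map_star' _ := rfl

/-- The C⋆-subalgebra of the product generated by the direct product of all covariant
representations. -/
def generated : NonUnitalStarSubalgebra ℂ (Ambient E) :=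
  (NonUnitalStarAlgebra.adjoin ℂ
    (Set.range (rep E).π₀ ∪ Set.range (rep E).π₁)).topologicalClosure

lemma isClosed_generated : IsClosed (generated E : Set (Ambient E)) :=
  NonUnitalStarSubalgebra.isClosed_topologicalClosure _

lemma π₀_mem (a : C₀(V, ℂ)) : (rep E).π₀ a ∈ generated E :=
  NonUnitalStarSubalgebra.le_topologicalClosure _
    (NonUnitalStarAlgebra.subset_adjoin ℂ _ (Or.inl ⟨a, rfl⟩))

lemma π₁_mem (ξ : Corr E) : (rep E).π₁ ξ ∈ generated E :=
  NonUnitalStarSubalgebra.le_topologicalClosure _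
    (NonUnitalStarAlgebra.subset_adjoin ℂ _ (Or.inr ⟨ξ, rfl⟩))

lemma gauge_mem (z : Circle) {x : Ambient E} (hx : x ∈ generated E) :
    gauge E z x ∈ generated E := by
  have hcont : Continuous (gauge E z) :=
    AddMonoidHomClass.continuous_of_bound (gauge E z) 1 fun a => by
      simpa using NonUnitalStarAlgHom.norm_apply_le (gauge E z) a
  have hle : generated E ≤ (generated E).comap (gauge E z) := by
    refine NonUnitalStarSubalgebra.topologicalClosure_minimal _ ?_
      ((isClosed_generated E).preimage hcont)
    refine NonUnitalStarAlgebra.adjoin_le ?_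
    rintro _ (⟨a, rfl⟩ | ⟨ξ, rfl⟩)
    · exact π₀_mem E a
    · exact (generated E).smul_mem (z : ℂ) (π₁_mem E ξ)
  exact hle hx

end Ambient

/-- The topological graph algebra `C⋆(E)`: the universal C⋆-algebra generated by a covariant
representation of `E`, realized inside the product of all covariant representations. -/
def CStar : Type (max u v + 1) := Ambient.generated E

namespace CStar

instance : NonUnitalCStarAlgebra (CStar E) :=
  NonUnitalStarSubalgebra.nonUnitalCStarAlgebra (Ambient.generated E)
    (h_closed := Ambient.isClosed_generated E)

/-- The inclusion of `C⋆(E)` in the product of all covariant representations. -/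
def incl : CStar E →⋆ₙₐ[ℂ] Ambient E := NonUnitalStarSubalgebraClass.subtype (Ambient.generated E)

lemma incl_injective : Function.Injective (incl E) := Subtype.val_injective

/-- The canonical (universal) representation of `E` on `C⋆(E)`. -/
def univ : ToeplitzRep E (CStar E) where
  π₀ := NonUnitalStarAlgHom.codRestrict (Ambient.rep E).π₀ (Ambient.generated E) (Ambient.π₀_mem E)
  π₁ :=
    { toFun := fun ξ => ⟨(Ambient.rep E).π₁ ξ, Ambient.π₁_mem E ξ⟩
      map_add' := fun a b => Subtype.ext (map_add (Ambient.rep E).π₁ a b)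
      map_smul' := fun c a => Subtype.ext (map_smul (Ambient.rep E).π₁ c a) }
  star_mul_eq ξ η := Subtype.ext ((Ambient.rep E).star_mul_eq ξ η)
  mul_eq a ξ := Subtype.ext ((Ambient.rep E).mul_eq a ξ)

/-- The `*`-homomorphism `C⋆(E) → A` induced by a covariant representation of `E` on `A`. -/
def lift (σ : CovariantRep E) : CStar E →⋆ₙₐ[ℂ] σ.A := (Ambient.eval E σ).comp (incl E)

lemma lift_π₀ (σ : CovariantRep E) (a : C₀(V, ℂ)) : lift E σ ((univ E).π₀ a) = σ.rep.π₀ a := rfl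

lemma lift_π₁ (σ : CovariantRep E) (ξ : Corr E) : lift E σ ((univ E).π₁ ξ) = σ.rep.π₁ ξ := rfl

lemma univ_isCovariant : (univ E).IsCovariant := by
  intro a ha
  apply incl_injective E
  apply lp.ext
  funext σ
  have h := (univ E).compactMap_map (lift E σ) ⟨Corr.leftAct E a, Corr.leftAct_mem_compacts E a ha⟩
  have h2 : (univ E).map (lift E σ) = σ.rep := rfl
  rw [h2, σ.isCovariant a ha] at h
  exact h.symm

/-- A `*`-homomorphism on `C⋆(E)` is determined by its values on the canonical generators. -/
lemma hom_ext {B : Type*} [NonUnitalCStarAlgebra B] {φ ψ : CStar E →⋆ₙₐ[ℂ] B}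
    (h₀ : ∀ a, φ ((univ E).π₀ a) = ψ ((univ E).π₀ a))
    (h₁ : ∀ ξ, φ ((univ E).π₁ ξ) = ψ ((univ E).π₁ ξ)) : φ = ψ := by
  have hc : ∀ χ : CStar E →⋆ₙₐ[ℂ] B, Continuous χ := fun χ =>
    AddMonoidHomClass.continuous_of_bound χ 1 fun a => by
      simpa using NonUnitalStarAlgHom.norm_apply_le χ a
  have key : ∀ x (hx : x ∈ NonUnitalStarAlgebra.adjoin ℂ
      (Set.range (Ambient.rep E).π₀ ∪ Set.range (Ambient.rep E).π₁)),
      φ ⟨x, NonUnitalStarSubalgebra.le_topologicalClosure _ hx⟩ =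
        ψ ⟨x, NonUnitalStarSubalgebra.le_topologicalClosure _ hx⟩ := by
    intro x hx
    induction hx using NonUnitalStarAlgebra.adjoin_induction with
    | mem x hx =>
      rcases hx with ⟨a, rfl⟩ | ⟨ξ, rfl⟩
      · exact h₀ a
      · exact h₁ ξ
    | add x y hx hy ihx ihy =>
      exact (map_add φ _ _).trans ((congrArg₂ (· + ·) ihx ihy).trans (map_add ψ _ _).symm)
    | zero => exact (map_zero φ).trans (map_zero ψ).symm
    | mul x y hx hy ihx ihy =>
      exact (map_mul φ _ _).trans ((congrArg₂ (· * ·) ihx ihy).trans (map_mul ψ _ _).symm)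
    | smul c x hx ih =>
      exact (map_smul φ c _).trans ((congrArg (c • ·) ih).trans (map_smul ψ c _).symm)
    | star x hx ih =>
      exact (map_star φ _).trans ((congrArg star ih).trans (map_star ψ _).symm)
  have hcl : IsClosed {x : CStar E | φ x = ψ x} := isClosed_eq (hc φ) (hc ψ)
  ext x
  have hx : (x : Ambient.generated E).1 ∈ closure (NonUnitalStarAlgebra.adjoin ℂ
      (Set.range (Ambient.rep E).π₀ ∪ Set.range (Ambient.rep E).π₁) : Set (Ambient E)) := x.2
  have hx' : x ∈ closure {y : CStar E | (y : Ambient.generated E).1 ∈ NonUnitalStarAlgebra.adjoin ℂ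
      (Set.range (Ambient.rep E).π₀ ∪ Set.range (Ambient.rep E).π₁)} := by
    refine (closure_subtype (x := (x : Ambient.generated E))).2 (closure_mono ?_ hx)
    intro y hy
    exact ⟨⟨y, NonUnitalStarSubalgebra.le_topologicalClosure _ hy⟩, hy, rfl⟩
  exact closure_minimal (fun y hy => key y.1 hy) hcl hx'

/-- The universal property of `C⋆(E)`. -/
lemma existsUnique_lift (σ : CovariantRep E) :
    ∃! φ : CStar E →⋆ₙₐ[ℂ] σ.A, (∀ a, φ ((univ E).π₀ a) = σ.rep.π₀ a) ∧
      ∀ ξ, φ ((univ E).π₁ ξ) = σ.rep.π₁ ξ :=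
  ⟨lift E σ, ⟨lift_π₀ E σ, lift_π₁ E σ⟩, fun _ h => hom_ext E h.1 h.2⟩

/-- The gauge action `γ` of the circle on `C⋆(E)`. -/
def gauge (z : Circle) : CStar E →⋆ₙₐ[ℂ] CStar E :=
  NonUnitalStarAlgHom.codRestrict ((Ambient.gauge E z).comp (incl E)) (Ambient.generated E)
    fun x => Ambient.gauge_mem E z x.2

lemma gauge_π₀ (z : Circle) (a : C₀(V, ℂ)) : gauge E z ((univ E).π₀ a) = (univ E).π₀ a := rfl

lemma gauge_π₁ (z : Circle) (ξ : Corr E) :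
    gauge E z ((univ E).π₁ ξ) = (z : ℂ) • (univ E).π₁ ξ := rfl

end CStar

open scoped ComplexOrder in
/-- A tracial state on a (not necessarily unital) C⋆-algebra: a positive linear functional of norm
one with `τ(xy) = τ(yx)`. -/
structure IsTracialState {A : Type*} [NonUnitalCStarAlgebra A] (τ : A →L[ℂ] ℂ) : Prop where
  nonneg : ∀ x, 0 ≤ τ (star x * x)
  norm_eq_one : ‖τ‖ = 1
  mul_comm : ∀ x y, τ (x * y) = τ (y * x)

/-- A real-valued compactly supported function on the vertices as an element of `C₀(E⁰)`. -/
def ofRealFun (f : C_c(V, ℝ)) : C₀(V, ℂ) where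
  toFun v := (f v : ℂ)
  continuous_toFun := by fun_prop
  zero_at_infty' := HasCompactSupport.is_zero_at_infty
    (f.hasCompactSupport.comp_left (g := fun x : ℝ => (x : ℂ)) Complex.ofReal_zero)

variable {E} in
/-- The positive functional `f ↦ τ(π⁰(f))` on `C_c(E⁰, ℝ)` induced by a tracial state `τ` on
`C⋆(E)`. -/
def vertexFunctional {τ : CStar E →L[ℂ] ℂ} (hτ : IsTracialState τ) : C_c(V, ℝ) →ₚ[ℝ] ℝ :=
  PositiveLinearMap.mk₀
    { toFun := fun f => (τ ((CStar.univ E).π₀ (ofRealFun f))).re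
      map_add' := fun f g => by
        have : ofRealFun (f + g) = ofRealFun f + ofRealFun g := by
          ext v; exact Complex.ofReal_add _ _
        rw [this, map_add, map_add, Complex.add_re]
      map_smul' := fun c f => by
        have : ofRealFun (c • f) = (c : ℂ) • ofRealFun f := by
          ext v; exact Complex.ofReal_mul _ _
        rw [this, map_smul, map_smul, smul_eq_mul, Complex.re_ofReal_mul]
        rfl }
    fun f hf => by
      have hf' : ∀ v, 0 ≤ f v := fun v => hf v
      let g : C_c(V, ℝ) := f.compLeft ⟨Real.sqrt, Real.continuous_sqrt⟩
      have hg : ∀ v, g v = √(f v) := fun v =>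
        CompactlySupportedContinuousMap.compLeft_apply (g := ⟨Real.sqrt, Real.continuous_sqrt⟩)
          Real.sqrt_zero f v
      have h1 : ofRealFun f = star (ofRealFun g) * ofRealFun g := by
        ext v
        change (f v : ℂ) = star (g v : ℂ) * (g v : ℂ)
        rw [Complex.star_def, Complex.conj_ofReal, hg, ← Complex.ofReal_mul,
          Real.mul_self_sqrt (hf' v)]
      change 0 ≤ (τ ((CStar.univ E).π₀ (ofRealFun f))).re
      rw [h1, map_mul, map_star]
      exact (Complex.le_def.1 (hτ.nonneg ((CStar.univ E).π₀ (ofRealFun g)))).1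

variable {E} in
/-- The Radon measure `μ` on `E⁰` induced by a tracial state `τ` on `C⋆(E)`: the measure with
`τ(π⁰(f)) = ∫ f dμ` given by the Riesz representation theorem. -/
def inducedMeasure [MeasurableSpace V] [BorelSpace V] {τ : CStar E →L[ℂ] ℂ}
    (hτ : IsTracialState τ) : MeasureTheory.Measure V :=
  RealRMK.rieszMeasure (vertexFunctional hτ)

lemma integral_inducedMeasure [MeasurableSpace V] [BorelSpace V] {τ : CStar E →L[ℂ] ℂ}
    (hτ : IsTracialState τ) (f : C_c(V, ℝ)) :
    ∫ v, f v ∂(inducedMeasure hτ) = (τ ((CStar.univ E).π₀ (ofRealFun f))).re :=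
  RealRMK.integral_rieszMeasure (vertexFunctional hτ) f

end

end TopologicalGraph

/-!
Words in the generators `π⁰(a)`, `π¹(ξ)`, `π¹(ξ)⋆` span a dense subspace of `C⋆(E)`
(`dense_span_isWord`), and the gauge action multiplies a word of degree `d` (the number of factors
`π¹(ξ)` minus the number of factors `π¹(ξ)⋆`) by `zᵈ`. Gauge invariance of `τ` therefore means that
`τ` vanishes on words of nonzero degree, and passing to adjoints reduces this to positive degree.

In a word of positive degree which is not a product of factors `π¹(ξ)` only, some `π¹(ξ)` is
preceded, up to cyclic rotation, by a factor `π⁰(a)` or `π¹(η)⋆`; the trace property permits the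
rotation, and the relations of a Toeplitz representation merge the two factors into one generator.
By induction on the length this leaves the products `π¹(ξ₁) ⋯ π¹(ξₖ)` with `k ≥ 1`
(`trace_wordProd_eq_zero_of_pos`).

By continuity the `ξᵢ` may be taken in `C_c(E¹)`. The resulting functional is multilinear, so by
compactness of supports and partitions of unity it vanishes as soon as it vanishes near each tuple
`(α₁, …, αₖ)` of edges (`multilinearMap_eq_zero_of_locally`). Near a tuple which is not a path the
product is zero; near a path with `s(αₖ) ≠ r(α₁)` the product is cut off on its two sides by
orthogonal vertex functions, and the trace property brings these together; near a cycle the product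
is cut off on the right by `π⁰(b)` with `∫ |b|² dμ = 0`, so `τ` vanishes on it by the Cauchy–Schwarz
inequality (`exists_nhds_trace_prod_eq_zero`).

Products indexed by lists are formed in the unitization of `C⋆(E)`.
-/

namespace TopologicalGraph

/-! ### Partitions of unity and multilinear maps on compactly supported functions -/

section Localization

variable {X : Type*} [TopologicalSpace X] [LocallyCompactSpace X] [T2Space X]

/-- A function in `C_c(X)` is a finite sum of functions supported in prescribed neighbourhoods of
points of its support. -/
lemma exists_sum_tsupport_subset (f : C_c(X, ℂ)) (N : X → Set X) (hN : ∀ x, IsOpen (N x))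
    (hxN : ∀ x, x ∈ N x) :
    ∃ (n : ℕ) (g : Fin n → C_c(X, ℂ)), f = ∑ i, g i ∧
      ∀ i, ∃ x ∈ tsupport f, tsupport (g i) ⊆ N x := by
  have hK : IsCompact (tsupport f) := f.hasCompactSupport
  obtain ⟨t, htK, ht⟩ := hK.elim_nhds_subcover N fun x _ => (hN x).mem_nhds (hxN x)
  let c : Fin t.card → X := fun i => t.equivFin.symm i
  have hc : tsupport f ⊆ ⋃ i, N (c i) := by
    intro x hx
    obtain ⟨y, hy, hxy⟩ := Set.mem_iUnion₂.1 (ht hx)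
    refine Set.mem_iUnion.2 ⟨t.equivFin ⟨y, hy⟩, ?_⟩
    simpa [c] using hxy
  obtain ⟨χ, hχN, hχ1, -, -⟩ :=
    exists_continuous_sum_one_of_isOpen_isCompact (fun i => hN (c i)) hK hc
  refine ⟨t.card, fun i => ⟨⟨fun x => (χ i x : ℂ) * f x, by fun_prop⟩,
    HasCompactSupport.mul_left (f := fun x => (χ i x : ℂ)) (f' := f) f.hasCompactSupport⟩, ?_,
    fun i => ⟨c i, htK _ (t.equivFin.symm i).2, ?_⟩⟩
  · ext x
    rw [CompactlySupportedContinuousMap.sum_apply]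
    simp only [CompactlySupportedContinuousMap.coe_mk, ContinuousMap.coe_mk]
    rw [← Finset.sum_mul]
    by_cases hx : f x = 0
    · simp [hx]
    · have := hχ1 (subset_tsupport _ hx)
      simp only [Finset.sum_apply, Pi.one_apply] at this
      rw [← Complex.ofReal_sum, this, Complex.ofReal_one, one_mul]
  · refine subset_trans (closure_mono fun x hx => ?_) (hχN i)
    intro h
    simp [h] at hx

/-- Vanishing of a multilinear map on `C_c(X)` is a local property at the points of `Xⁿ`. -/
lemma multilinearMap_eq_zero_of_locally {ι : Type*} [Finite ι]
    (F : MultilinearMap ℂ (fun _ : ι => C_c(X, ℂ)) ℂ)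
    (hF : ∀ x : ι → X, ∃ U : ι → Set X, (∀ i, IsOpen (U i)) ∧ (∀ i, x i ∈ U i) ∧
      ∀ f : ι → C_c(X, ℂ), (∀ i, tsupport (f i) ⊆ U i) → F f = 0) : F = 0 := by
  classical
  have := Fintype.ofFinite ι
  ext f
  choose U hU hxU hFU using hF
  have hK : IsCompact (Set.univ.pi fun i => tsupport (f i)) :=
    isCompact_univ_pi fun i => (f i).hasCompactSupport
  obtain ⟨t, -, ht⟩ := hK.elim_nhds_subcover (fun x => Set.univ.pi (U x)) fun x _ =>
    (isOpen_set_pi Set.finite_univ fun i _ => hU x i).mem_nhds fun i _ => hxU x i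
  -- A product of the sets `N i (y i)` lies in one of the finitely many boxes of the cover.
  let N : ι → X → Set X := fun i y => ⋂ x ∈ t.filter fun x => y ∈ U x i, U x i
  choose n g hfg hg using fun i => exists_sum_tsupport_subset (f i) (N i)
    (fun y => isOpen_biInter_finset fun x _ => hU x i)
    (fun y => Set.mem_iInter₂.2 fun x hx => (Finset.mem_filter.1 hx).2)
  rw [show f = fun i => ∑ j, g i j from funext hfg, MultilinearMap.map_sum,
    zero_apply]
  refine Finset.sum_eq_zero fun r _ => ?_
  choose y hy hgy using fun i => hg i (r i)
  obtain ⟨x, hxt, hyx⟩ := Set.mem_iUnion₂.1 (ht fun i _ => hy i)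
  exact hFU x _ fun i => (hgy i).trans
    (Set.biInter_subset_of_mem (Finset.mem_filter.2 ⟨hxt, hyx i trivial⟩))

end Localization

/-! ### Tracial positive functionals and their extension to the unitization -/

section Trace

variable {A : Type*} [NonUnitalCStarAlgebra A] {τ : A →L[ℂ] ℂ}

open scoped ComplexOrder

/-- A tracial state as a positive linear map for the spectral order of the algebra. -/
lemma IsTracialState.exists_positiveLinearMap [PartialOrder A] [StarOrderedRing A]
    (hτ : IsTracialState τ) : ∃ f : A →ₚ[ℂ] ℂ, ∀ x, f x = τ x := by
  refine ⟨PositiveLinearMap.mk₀ (τ : A →ₗ[ℂ] ℂ) fun x hx => ?_, fun _ => rfl⟩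
  obtain ⟨y, rfl⟩ := CStarAlgebra.nonneg_iff_eq_star_mul_self.1 hx
  exact hτ.nonneg y

lemma IsTracialState.apply_star (hτ : IsTracialState τ) (x : A) : τ (star x) = star (τ x) := by
  let := CStarAlgebra.spectralOrder A
  let := CStarAlgebra.spectralOrderedRing A
  obtain ⟨f, hf⟩ := hτ.exists_positiveLinearMap
  rw [← hf, ← hf, map_star]

/-- If `τ(c⋆c) = 0`, then `τ` vanishes on the left ideal generated by `c`, by the Cauchy–Schwarz
inequality for the GNS inner product. -/
lemma IsTracialState.mul_eq_zero (hτ : IsTracialState τ) {c : A} (hc : τ (star c * c) = 0)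
    (x : A) : τ (x * c) = 0 := by
  let := CStarAlgebra.spectralOrder A
  let := CStarAlgebra.spectralOrderedRing A
  obtain ⟨f, hf⟩ := hτ.exists_positiveLinearMap
  have hnorm : ‖f.toPreGNS c‖ = 0 := by
    rw [f.preGNS_norm_def, f.ofPreGNS_toPreGNS, hf, hc]
    simp
  have h := norm_inner_le_norm (𝕜 := ℂ) (f.toPreGNS (star x)) (f.toPreGNS c)
  rw [hnorm, mul_zero, norm_le_zero_iff, f.preGNS_inner_def] at h
  simpa [hf] using h

variable (τ) in
/-- The functional `λ + x ↦ τ(x)` on the unitization. It is tracial when `τ` is (but not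
positive), and makes `τ` available on products indexed by lists. -/
noncomputable def unitizationTrace : Unitization ℂ A →L[ℂ] ℂ :=
  τ ∘L ⟨Unitization.sndHom ℂ ℂ A, Unitization.continuous_snd⟩

lemma unitizationTrace_apply (x : Unitization ℂ A) : unitizationTrace τ x = τ x.snd := rfl

lemma unitizationTrace_inr (x : A) : unitizationTrace τ (x : Unitization ℂ A) = τ x := rfl

lemma unitizationTrace_mul_comm (hτ : IsTracialState τ) (x y : Unitization ℂ A) :
    unitizationTrace τ (x * y) = unitizationTrace τ (y * x) := by
  simp only [unitizationTrace_apply, Unitization.snd_mul, map_add, hτ.mul_comm x.snd y.snd]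
  ring

end Trace

/-! ### Products indexed by `Fin` -/

section Products

variable {R : Type*} [MonoidWithZero R]

lemma prod_ofFn_eq_zero : ∀ {n : ℕ} (x : Fin (n + 1) → R) (i : Fin n),
    x i.castSucc * x i.succ = 0 → (List.ofFn x).prod = 0
  | 0, _, i, _ => i.elim0
  | n + 1, x, i, h => by
    rw [List.ofFn_succ, List.prod_cons]
    induction i using Fin.cases with
    | zero =>
      rw [List.ofFn_succ, List.prod_cons, ← mul_assoc]
      change x 0 * x (Fin.succ 0) * _ = 0
      rw [show x 0 * x (Fin.succ 0) = 0 from h, zero_mul]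
    | succ j => rw [prod_ofFn_eq_zero (fun k => x k.succ) j h, mul_zero]

lemma mul_prod_ofFn {n : ℕ} (x : Fin (n + 1) → R) {a : R} (h : a * x 0 = x 0) :
    a * (List.ofFn x).prod = (List.ofFn x).prod := by
  rw [List.ofFn_succ, List.prod_cons, ← mul_assoc, h]

lemma prod_ofFn_mul {n : ℕ} (x : Fin (n + 1) → R) {b : R}
    (h : x (Fin.last n) * b = x (Fin.last n)) :
    (List.ofFn x).prod * b = (List.ofFn x).prod := by
  rw [List.ofFn_succ', List.prod_concat, mul_assoc, h]

end Products

noncomputable section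

variable {V : Type u} {W : Type v} [TopologicalSpace V] [LocallyCompactSpace V] [T2Space V]
  [TopologicalSpace W] [LocallyCompactSpace W] [T2Space W] {E : TopologicalGraph V W}

/-! ### Cutting off edge functions by vertex functions -/

lemma ofRealFun_mul_eq_zero {b c : C_c(V, ℝ)} {O O' : Set V} (hb : tsupport b ⊆ O)
    (hc : tsupport c ⊆ O') (hO : Disjoint O O') : ofRealFun b * ofRealFun c = 0 := by
  ext v
  change (b v : ℂ) * (c v : ℂ) = 0
  rw [mul_eq_zero, Complex.ofReal_eq_zero, Complex.ofReal_eq_zero]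
  by_contra! h
  exact hO.notMem_of_mem_left (hb (subset_tsupport _ h.1)) (hc (subset_tsupport _ h.2))

/-- An edge function supported over an open set `O` of vertices, with respect to a continuous map
`p` (the range or the source map), is fixed by multiplication with `b ∘ p` for some vertex function
`b` supported in `O`. -/
lemma exists_mulFun_pullback_eq (p : C(W, V)) {O : Set V} (hO : IsOpen O) (f : C_c(W, ℂ))
    (hf : tsupport f ⊆ p ⁻¹' O) :
    ∃ b : C_c(V, ℝ), tsupport b ⊆ O ∧
      PreModule.mulFun (pullback p (ofRealFun b)) (PreModule.ofFunc f) =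
        (PreModule.ofFunc f : PreModule E) := by
  have hK : IsCompact (p '' tsupport f) := IsCompact.image f.hasCompactSupport p.continuous
  obtain ⟨K, hKc, hK1, hK2⟩ := exists_compact_between hK hO (Set.image_subset_iff.2 hf)
  obtain ⟨b, hb1, hb0, hbc, -⟩ := exists_continuous_one_zero_of_isCompact hK
    (isOpen_interior (s := K)).isClosed_compl (Set.disjoint_compl_right_iff_subset.2 hK1)
  refine ⟨⟨b, hbc⟩, ?_, ?_⟩
  · refine (closure_minimal (fun x hx => ?_) hKc.isClosed).trans hK2
    by_contra hxK
    exact hx (hb0 fun h => hxK (interior_subset h))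
  · ext e
    change (b (p e) : ℂ) * f e = f e
    by_cases he : f e = 0
    · simp [he]
    · rw [hb1 ⟨e, subset_tsupport _ he, rfl⟩]
      simp

/-- The image `π¹(f)` of `f ∈ C_c(E¹)` under a Toeplitz representation. -/
def ToeplitzRep.edge {A : Type*} [NonUnitalCStarAlgebra A] (ρ : ToeplitzRep E A) :
    C_c(W, ℂ) →ₗ[ℂ] A :=
  ρ.π₁ ∘ₗ (Corr.ofPre E : PreModule E →ₗ[ℂ] Corr E) ∘ₗ
    { toFun := PreModule.ofFunc
      map_add' := fun _ _ => rfl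
      map_smul' := fun _ _ => rfl }

lemma ToeplitzRep.exists_π₀_mul_edge {A : Type*} [NonUnitalCStarAlgebra A]
    (ρ : ToeplitzRep E A) {O : Set V} (hO : IsOpen O) (f : C_c(W, ℂ))
    (hf : tsupport f ⊆ E.r ⁻¹' O) :
    ∃ b : C_c(V, ℝ), tsupport b ⊆ O ∧ ρ.π₀ (ofRealFun b) * ρ.edge f = ρ.edge f := by
  obtain ⟨b, hb, hbf⟩ := exists_mulFun_pullback_eq (E := E) E.rMap hO f hf
  refine ⟨b, hb, ?_⟩
  change ρ.π₀ _ * ρ.π₁ (Corr.ofPre E (PreModule.ofFunc f)) =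
    ρ.π₁ (Corr.ofPre E (PreModule.ofFunc f))
  rw [ρ.mul_eq, Corr.leftAct, Corr.mulOp_ofPre, hbf]

lemma ToeplitzRep.exists_edge_mul_π₀ {A : Type*} [NonUnitalCStarAlgebra A]
    (ρ : ToeplitzRep E A) {O : Set V} (hO : IsOpen O) (f : C_c(W, ℂ))
    (hf : tsupport f ⊆ E.s ⁻¹' O) :
    ∃ b : C_c(V, ℝ), tsupport b ⊆ O ∧ ρ.edge f * ρ.π₀ (ofRealFun b) = ρ.edge f := by
  obtain ⟨b, hb, hbf⟩ := exists_mulFun_pullback_eq (E := E) E.sMap hO f hf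
  refine ⟨b, hb, ?_⟩
  change ρ.π₁ (Corr.ofPre E (PreModule.ofFunc f)) * ρ.π₀ _ =
    ρ.π₁ (Corr.ofPre E (PreModule.ofFunc f))
  rw [ρ.π₁_mul_π₀, Corr.rightAct_ofPre]
  exact congrArg (fun ξ => ρ.π₁ (Corr.ofPre E ξ)) hbf

/-! ### Products of edge elements -/

variable {τ : CStar E →L[ℂ] ℂ}

lemma apply_star_mul_self_eq_zero [MeasurableSpace V] [BorelSpace V] (hτ : IsTracialState τ)
    {O : Set V} (hO : inducedMeasure hτ O = 0) {b : C_c(V, ℝ)} (hb : tsupport b ⊆ O) :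
    τ (star ((CStar.univ E).π₀ (ofRealFun b)) * (CStar.univ E).π₀ (ofRealFun b)) = 0 := by
  have hint : ∫ v, (b * b) v ∂(inducedMeasure hτ) = 0 := by
    refine MeasureTheory.integral_eq_zero_of_ae ?_
    refine MeasureTheory.measure_mono_null (fun v hv => hb (subset_tsupport _ ?_)) hO
    intro h
    apply hv
    change b v * b v = 0
    rw [h, zero_mul]
  have hmul : star ((CStar.univ E).π₀ (ofRealFun b)) * (CStar.univ E).π₀ (ofRealFun b) =
      (CStar.univ E).π₀ (ofRealFun (b * b)) := by
    rw [← map_star, ← map_mul]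
    congr 1
    ext v
    change star (b v : ℂ) * (b v : ℂ) = ((b v * b v : ℝ) : ℂ)
    rw [Complex.star_def, Complex.conj_ofReal, Complex.ofReal_mul]
  refine Complex.ext ?_ (Complex.le_def.1 (hτ.nonneg _)).2.symm
  rw [hmul, ← integral_inducedMeasure E hτ, hint, Complex.zero_re]

variable (E) in
/-- Local vanishing of `τ` on products `π¹(f₁) ⋯ π¹(fₖ)` near a tuple `α` of edges. If `α` is not a
path, two consecutive factors are orthogonal; if it is a path whose source and range differ, the
trace property moves orthogonal vertex functions next to each other; if it is a cycle, the last
factor is cut off by a vertex function living on a null set. -/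
lemma exists_nhds_trace_prod_eq_zero [MeasurableSpace V] [BorelSpace V] (hτ : IsTracialState τ)
    (hcycle : ∀ (n : ℕ) (α : Fin (n + 1) → W), E.IsCycle α →
      E.s (α (Fin.last n)) ∉ (inducedMeasure hτ).support)
    {n : ℕ} (α : Fin (n + 1) → W) :
    ∃ U : Fin (n + 1) → Set W, (∀ i, IsOpen (U i)) ∧ (∀ i, α i ∈ U i) ∧
      ∀ f : Fin (n + 1) → C_c(W, ℂ), (∀ i, tsupport (f i) ⊆ U i) →
        unitizationTrace τ
          (List.ofFn fun i => ((CStar.univ E).edge (f i) : Unitization ℂ (CStar E))).prod = 0 := by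
  classical
  set ρ := CStar.univ E
  by_cases hpath : ∀ i : Fin n, E.s (α i.castSucc) = E.r (α i.succ)
  swap
  · -- Consecutive factors at a gap in the tuple are orthogonal.
    push Not at hpath
    obtain ⟨i, hi⟩ := hpath
    obtain ⟨O, O', hO, hO', hsO, hrO', hdisj⟩ := t2_separation hi
    refine ⟨fun j => (if j = i.castSucc then E.s ⁻¹' O else Set.univ) ∩
      if j = i.succ then E.r ⁻¹' O' else Set.univ, fun j => ?_, fun j => ?_, fun f hf => ?_⟩
    · refine IsOpen.inter ?_ ?_
      · split_ifs
        exacts [hO.preimage E.continuous_s, isOpen_univ]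
      · split_ifs
        exacts [hO'.preimage E.continuous_r, isOpen_univ]
    · refine ⟨?_, ?_⟩
      · split_ifs with h
        exacts [h ▸ hsO, trivial]
      · split_ifs with h
        exacts [h ▸ hrO', trivial]
    · obtain ⟨b, hb, hbf⟩ := ρ.exists_edge_mul_π₀ hO (f i.castSucc)
        fun e he => by simpa using (hf i.castSucc he).1
      obtain ⟨c, hc, hcf⟩ := ρ.exists_π₀_mul_edge hO' (f i.succ)
        fun e he => by simpa using (hf i.succ he).2
      have h0 : ρ.edge (f i.castSucc) * ρ.edge (f i.succ) = 0 := by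
        rw [← hbf, ← hcf, mul_assoc, ← mul_assoc (ρ.π₀ _), ← map_mul,
          ofRealFun_mul_eq_zero hb hc hdisj, map_zero, zero_mul, mul_zero]
      rw [prod_ofFn_eq_zero _ i (by rw [← Unitization.inr_mul, h0, Unitization.inr_zero]),
        map_zero]
  by_cases hloop : E.s (α (Fin.last n)) = E.r (α 0)
  · -- A cycle: its base point has a null neighbourhood, so Cauchy–Schwarz applies.
    obtain ⟨N, hN, hN0⟩ :=
      MeasureTheory.Measure.notMem_support_iff_exists.1 (hcycle n α ⟨hpath, hloop⟩)
    obtain ⟨O, hON, hO, hαO⟩ := mem_nhds_iff.1 hN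
    have hO0 := MeasureTheory.measure_mono_null hON hN0
    refine ⟨fun j => if j = Fin.last n then E.s ⁻¹' O else Set.univ, fun j => ?_, fun j => ?_,
      fun f hf => ?_⟩
    · dsimp only
      split_ifs
      exacts [hO.preimage E.continuous_s, isOpen_univ]
    · dsimp only
      split_ifs with h
      exacts [h ▸ hαO, trivial]
    · obtain ⟨b, hb, hbf⟩ := ρ.exists_edge_mul_π₀ hO (f (Fin.last n))
        fun e he => by simpa using hf (Fin.last n) he
      rw [← prod_ofFn_mul _ (b := (ρ.π₀ (ofRealFun b) : Unitization ℂ (CStar E)))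
        (by rw [← Unitization.inr_mul, hbf])]
      set P := (List.ofFn fun i => (ρ.edge (f i) : Unitization ℂ (CStar E))).prod with hP
      have hfst : P.fst = 0 := by
        rw [hP, List.ofFn_succ, List.prod_cons, Unitization.fst_mul, Unitization.fst_inr, zero_mul]
      rw [unitizationTrace_apply, Unitization.snd_mul, hfst, Unitization.fst_inr,
        Unitization.snd_inr, zero_smul, zero_smul, zero_add, zero_add]
      exact hτ.mul_eq_zero (apply_star_mul_self_eq_zero hτ hO0 hb) _
  · -- The product is cut off by orthogonal vertex functions on its two sides.
    obtain ⟨O, O', hO, hO', hsO, hrO', hdisj⟩ := t2_separation hloop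
    refine ⟨fun j => (if j = Fin.last n then E.s ⁻¹' O else Set.univ) ∩
      if j = 0 then E.r ⁻¹' O' else Set.univ, fun j => ?_, fun j => ?_, fun f hf => ?_⟩
    · refine IsOpen.inter ?_ ?_
      · split_ifs
        exacts [hO.preimage E.continuous_s, isOpen_univ]
      · split_ifs
        exacts [hO'.preimage E.continuous_r, isOpen_univ]
    · refine ⟨?_, ?_⟩
      · split_ifs with h
        exacts [h ▸ hsO, trivial]
      · split_ifs with h
        exacts [h ▸ hrO', trivial]
    · obtain ⟨b, hb, hbf⟩ := ρ.exists_edge_mul_π₀ hO (f (Fin.last n))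
        fun e he => by simpa using (hf (Fin.last n) he).1
      obtain ⟨c, hc, hcf⟩ := ρ.exists_π₀_mul_edge hO' (f 0)
        fun e he => by simpa using (hf 0 he).2
      rw [← mul_prod_ofFn _ (a := (ρ.π₀ (ofRealFun c) : Unitization ℂ (CStar E)))
        (by rw [← Unitization.inr_mul, hcf]),
        ← prod_ofFn_mul _ (b := (ρ.π₀ (ofRealFun b) : Unitization ℂ (CStar E)))
        (by rw [← Unitization.inr_mul, hbf]),
        unitizationTrace_mul_comm hτ, mul_assoc, ← Unitization.inr_mul, ← map_mul,
        ofRealFun_mul_eq_zero hb hc hdisj, map_zero, Unitization.inr_zero, mul_zero, map_zero]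

/-- Both sides are continuous in the `ξᵢ`, so these may be taken in `C_c(E¹)`, where the local
vanishing near every tuple of edges suffices. -/
lemma trace_prod_π₁_eq_zero [MeasurableSpace V] [BorelSpace V] (hτ : IsTracialState τ)
    (hcycle : ∀ (n : ℕ) (α : Fin (n + 1) → W), E.IsCycle α →
      E.s (α (Fin.last n)) ∉ (inducedMeasure hτ).support)
    {n : ℕ} (ξ : Fin (n + 1) → Corr E) :
    unitizationTrace τ
      (List.ofFn fun i => ((CStar.univ E).π₁ (ξ i) : Unitization ℂ (CStar E))).prod = 0 := by
  set ρ := CStar.univ E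
  let ι : CStar E →ₗ[ℂ] Unitization ℂ (CStar E) := Unitization.inrHom ℂ ℂ (CStar E)
  let F : MultilinearMap ℂ (fun _ : Fin (n + 1) => C_c(W, ℂ)) ℂ :=
    (unitizationTrace τ : Unitization ℂ (CStar E) →ₗ[ℂ] ℂ).compMultilinearMap
      ((MultilinearMap.mkPiAlgebraFin ℂ (n + 1) (Unitization ℂ (CStar E))).compLinearMap
        fun _ => ι ∘ₗ ρ.edge)
  have hF : F = 0 := multilinearMap_eq_zero_of_locally F
    fun α => exists_nhds_trace_prod_eq_zero E hτ hcycle α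
  have hπ₁ : Continuous ρ.π₁ :=
    AddMonoidHomClass.continuous_of_bound ρ.π₁ 1 fun ξ => by simpa using ρ.norm_π₁_le ξ
  have hι : Continuous ι := Unitization.continuous_inr
  have hcont : Continuous fun ξ : Fin (n + 1) → Corr E => unitizationTrace τ
      (MultilinearMap.mkPiAlgebraFin ℂ (n + 1) _ fun i => ι (ρ.π₁ (ξ i))) :=
    (unitizationTrace τ).continuous.comp
      ((ContinuousMultilinearMap.mkPiAlgebraFin ℂ (n + 1) (Unitization ℂ (CStar E))).cont.comp
        (continuous_pi fun i => hι.comp (hπ₁.comp (continuous_apply i))))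
  have hdense : DenseRange (Pi.map fun _ : Fin (n + 1) => Corr.ofPre E) :=
    DenseRange.piMap fun _ => Corr.denseRange_ofPre E
  exact hdense.induction_on ξ (isClosed_eq hcont continuous_const) fun f =>
    DFunLike.congr_fun hF fun i => (f i).toFunc

/-! ### Words in the generators -/

variable (E) in
/-- A letter: one of the generators `π⁰(a)`, `π¹(ξ)`, `π¹(ξ)⋆` of `C⋆(E)`. -/
inductive Letter : Type (max u v)
  /-- The letter `π⁰(a)`. -/
  | vertex (a : C₀(V, ℂ))
  /-- The letter `π¹(ξ)`. -/
  | edge (ξ : Corr E)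
  /-- The letter `π¹(ξ)⋆`. -/
  | coedge (ξ : Corr E)

namespace Letter

/-- The element of `C⋆(E)` denoted by a letter. -/
def val : Letter E → CStar E
  | vertex a => (CStar.univ E).π₀ a
  | edge ξ => (CStar.univ E).π₁ ξ
  | coedge ξ => star ((CStar.univ E).π₁ ξ)

/-- The degree of a letter for the grading of `C⋆(E)` by the gauge action. -/
def degree : Letter E → ℤ
  | vertex _ => 0
  | edge _ => 1
  | coedge _ => -1

/-- The adjoint letter. -/
def adjoint : Letter E → Letter E
  | vertex a => vertex (star a)
  | edge ξ => coedge ξ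
  | coedge ξ => edge ξ

lemma val_adjoint (x : Letter E) : x.adjoint.val = star x.val := by
  cases x
  exacts [map_star _ _, rfl, (star_star _).symm]

lemma degree_adjoint (x : Letter E) : x.adjoint.degree = -x.degree := by
  cases x <;> rfl

lemma gauge_val (z : Circle) (x : Letter E) :
    CStar.gauge E z x.val = (z : ℂ) ^ x.degree • x.val := by
  cases x with
  | vertex a => simp [val, degree, CStar.gauge_π₀]
  | edge ξ => simp [val, degree, CStar.gauge_π₁]
  | coedge ξ =>
    simp only [val, degree, map_star, CStar.gauge_π₁, star_smul, zpow_neg, zpow_one]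
    rw [← Circle.coe_inv, Circle.coe_inv_eq_conj, Complex.star_def]

/-- A letter other than `π¹(η)` can be merged with a following `π¹(ξ)`. -/
lemma exists_val_mul_edge (x : Letter E) (hx : ∀ η, x ≠ edge η) (ξ : Corr E) :
    ∃ y : Letter E, y.val = x.val * (edge ξ).val ∧ y.degree = x.degree + 1 := by
  cases x with
  | vertex a => exact ⟨edge (Corr.leftAct E a ξ), ((CStar.univ E).mul_eq a ξ).symm, rfl⟩
  | edge η => exact absurd rfl (hx η)
  | coedge η => exact ⟨vertex (Corr.innerL E η ξ), ((CStar.univ E).star_mul_eq η ξ).symm, rfl⟩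

lemma degree_nonpos (x : Letter E) (hx : ∀ η, x ≠ edge η) : x.degree ≤ 0 := by
  cases x with
  | vertex a => exact le_rfl
  | edge η => exact absurd rfl (hx η)
  | coedge η => exact neg_nonpos.2 zero_le_one

end Letter

/-- The product of the letters of a word, in the unitization of `C⋆(E)`. -/
def wordProd (l : List (Letter E)) : Unitization ℂ (CStar E) :=
  (l.map fun x => (x.val : Unitization ℂ (CStar E))).prod

/-- The degree of a word: the number of letters `π¹(ξ)` minus the number of letters `π¹(ξ)⋆`. -/
def wordDegree (l : List (Letter E)) : ℤ := (l.map Letter.degree).sum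

@[simp] lemma wordProd_append (l m : List (Letter E)) :
    wordProd (l ++ m) = wordProd l * wordProd m := by
  simp [wordProd]

@[simp] lemma wordProd_cons (x : Letter E) (l : List (Letter E)) :
    wordProd (x :: l) = x.val * wordProd l := by
  simp [wordProd]

@[simp] lemma wordDegree_append (l m : List (Letter E)) :
    wordDegree (l ++ m) = wordDegree l + wordDegree m := by
  simp [wordDegree]

@[simp] lemma wordDegree_cons (x : Letter E) (l : List (Letter E)) :
    wordDegree (x :: l) = x.degree + wordDegree l := by
  simp [wordDegree]

lemma wordDegree_nonpos (l : List (Letter E)) (h : ∀ x ∈ l, x.degree ≤ 0) : wordDegree l ≤ 0 := by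
  induction l with
  | nil => exact le_rfl
  | cons x l ih =>
    rw [wordDegree_cons]
    exact add_nonpos (h x List.mem_cons_self) (ih fun y hy => h y (List.mem_cons_of_mem _ hy))

lemma star_wordProd (l : List (Letter E)) :
    star (wordProd l) = wordProd (l.map Letter.adjoint).reverse := by
  induction l with
  | nil => simp [wordProd]
  | cons x l ih =>
    rw [wordProd_cons, star_mul, ih, List.map_cons, List.reverse_cons, wordProd_append,
      wordProd_cons, Letter.val_adjoint, Unitization.inr_star]
    simp [wordProd]

lemma wordDegree_reverse_adjoint (l : List (Letter E)) :
    wordDegree (l.map Letter.adjoint).reverse = -wordDegree l := by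
  induction l with
  | nil => simp [wordDegree]
  | cons x l ih =>
    rw [List.map_cons, List.reverse_cons, wordDegree_append, ih, wordDegree_cons, wordDegree_cons,
      Letter.degree_adjoint]
    simp [wordDegree]

/-- If a word that does not begin with an edge letter contains one, then some edge letter is
preceded by a letter of another kind. -/
lemma exists_eq_append_edge (x : Letter E) (hx : ∀ η, x ≠ .edge η) (l : List (Letter E))
    (hl : ∃ ξ, Letter.edge ξ ∈ l) :
    ∃ (p q : List (Letter E)) (y : Letter E) (ξ : Corr E), (∀ η, y ≠ .edge η) ∧
      x :: l = p ++ y :: .edge ξ :: q := by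
  induction l generalizing x with
  | nil => simp at hl
  | cons h t ih =>
    by_cases hh : ∃ ξ, h = .edge ξ
    · obtain ⟨ξ, rfl⟩ := hh
      exact ⟨[], t, x, ξ, hx, rfl⟩
    · push Not at hh
      obtain ⟨ξ, hξ⟩ := hl
      obtain ⟨p, q, y, η, hy, heq⟩ :=
        ih h hh ⟨ξ, (List.mem_cons.1 hξ).resolve_left fun h' => hh ξ h'.symm⟩
      exact ⟨x :: p, q, y, η, hy, by rw [heq, List.cons_append]⟩

/-- A tracial state vanishes on words of positive degree if it vanishes on nonempty words in the
letters `π¹(ξ)`: up to cyclic rotation, every other word of positive degree has a letter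
`π¹(ξ)` preceded by a letter of another kind, and these two letters merge into one. -/
lemma trace_wordProd_eq_zero_of_pos (hτ : IsTracialState τ)
    (hedge : ∀ (n : ℕ) (ξ : Fin (n + 1) → Corr E), unitizationTrace τ
      (List.ofFn fun i => ((CStar.univ E).π₁ (ξ i) : Unitization ℂ (CStar E))).prod = 0)
    (l : List (Letter E)) (hl : 0 < wordDegree l) : unitizationTrace τ (wordProd l) = 0 := by
  induction hn : l.length using Nat.strong_induction_on generalizing l with
  | _ n ih =>
  by_cases hall : ∀ x ∈ l, ∃ ξ, x = .edge ξ
  · obtain ⟨m, rfl⟩ : l ∈ Set.range (List.map Letter.edge) := by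
      rw [Set.range_list_map]
      intro x hx
      obtain ⟨ξ, rfl⟩ := hall x hx
      exact ⟨ξ, rfl⟩
    cases m with
    | nil => simp [wordDegree] at hl
    | cons ξ m =>
      have h := hedge m.length (ξ :: m).get
      rw [← Function.comp_def (fun η => ((CStar.univ E).π₁ η : Unitization ℂ (CStar E))),
        ← List.map_ofFn, List.ofFn_get] at h
      rw [wordProd, List.map_map]
      exact h
  · push Not at hall
    obtain ⟨x, hxl, hx⟩ := hall
    obtain ⟨p, q, rfl⟩ := List.append_of_mem hxl
    simp only [wordDegree_append, wordDegree_cons] at hl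
    have hedge_mem : ∃ ξ, Letter.edge ξ ∈ q ++ p := by
      by_contra! h
      have : wordDegree (q ++ p) ≤ 0 :=
        wordDegree_nonpos _ fun y hy => y.degree_nonpos fun η hη => h η (hη ▸ hy)
      rw [wordDegree_append] at this
      have := x.degree_nonpos hx
      omega
    obtain ⟨p', q', y, ξ, hy, heq⟩ := exists_eq_append_edge x hx (q ++ p) hedge_mem
    obtain ⟨w, hw, hwd⟩ := y.exists_val_mul_edge hy ξ
    have hdeg := congrArg wordDegree heq
    have hlen := congrArg List.length heq
    have hprod := congrArg wordProd heq
    simp only [wordDegree_append, wordDegree_cons] at hdeg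
    simp only [List.length_append, List.length_cons] at hlen hn
    have key := ih (p' ++ w :: q').length (by simp only [List.length_append, List.length_cons]; omega)
      (p' ++ w :: q') (by
        simp only [wordDegree_append, wordDegree_cons]
        have : (Letter.edge ξ).degree = 1 := rfl
        omega) rfl
    rw [wordProd_append, wordProd_cons, hw, Unitization.inr_mul, mul_assoc, ← wordProd_cons,
      ← wordProd_cons, ← wordProd_append, ← heq] at key
    rw [wordProd_append, unitizationTrace_mul_comm hτ, ← wordProd_append]
    exact key

lemma trace_wordProd_eq_zero (hτ : IsTracialState τ)
    (hedge : ∀ (n : ℕ) (ξ : Fin (n + 1) → Corr E), unitizationTrace τ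
      (List.ofFn fun i => ((CStar.univ E).π₁ (ξ i) : Unitization ℂ (CStar E))).prod = 0)
    (l : List (Letter E)) (hl : wordDegree l ≠ 0) : unitizationTrace τ (wordProd l) = 0 := by
  rcases hl.lt_or_gt with h | h
  · have h0 := trace_wordProd_eq_zero_of_pos hτ hedge (l.map Letter.adjoint).reverse
      (by rw [wordDegree_reverse_adjoint]; omega)
    rw [← star_wordProd, unitizationTrace_apply, Unitization.snd_star, hτ.apply_star,
      star_eq_zero] at h0
    exact h0
  · exact trace_wordProd_eq_zero_of_pos hτ hedge l h

/-! ### Density of the span of the words -/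

/-- An element of `C⋆(E)` that is the product of a word and on which the gauge action is given by
the degree of that word. The word is part of an existential statement because distinct words may
denote the same element. -/
def IsWord (x : CStar E) : Prop :=
  ∃ l : List (Letter E), (x : Unitization ℂ (CStar E)) = wordProd l ∧
    ∀ z : Circle, CStar.gauge E z x = (z : ℂ) ^ wordDegree l • x

lemma Letter.isWord (x : Letter E) : IsWord x.val :=
  ⟨[x], by simp [wordProd], fun z => by simp [wordDegree, x.gauge_val]⟩

lemma IsWord.mul {x y : CStar E} (hx : IsWord x) (hy : IsWord y) : IsWord (x * y) := by
  obtain ⟨l, hl, hlz⟩ := hx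
  obtain ⟨m, hm, hmz⟩ := hy
  refine ⟨l ++ m, by rw [Unitization.inr_mul, hl, hm, wordProd_append], fun z => ?_⟩
  rw [map_mul, hlz, hmz, smul_mul_smul_comm, wordDegree_append, zpow_add₀ z.coe_ne_zero]

variable (E) in
/-- The span of the products of generators and their adjoints is dense in `C⋆(E)`. -/
lemma dense_span_isWord :
    (Submodule.span ℂ {x : CStar E | IsWord x}).topologicalClosure = ⊤ := by
  set S : Set (CStar E) := Set.range (CStar.univ E).π₀ ∪ Set.range (CStar.univ E).π₁
  have hadj : (NonUnitalStarAlgebra.adjoin ℂ S : Set (CStar E)) ⊆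
      Submodule.span ℂ {x : CStar E | IsWord x} := by
    have h : (NonUnitalStarAlgebra.adjoin ℂ S).toSubmodule ≤
        Submodule.span ℂ {x : CStar E | IsWord x} := by
      rw [NonUnitalStarAlgebra.adjoin_eq_span]
      refine Submodule.span_mono fun x hx => ?_
      induction hx using Subsemigroup.closure_induction with
      | mem x hx =>
        rcases hx with (⟨a, rfl⟩ | ⟨ξ, rfl⟩) | (⟨a, ha⟩ | ⟨ξ, hξ⟩)
        · exact (Letter.vertex a).isWord
        · exact (Letter.edge ξ).isWord
        · rw [← star_star x, ← ha, ← map_star]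
          exact (Letter.vertex (star a)).isWord
        · rw [← star_star x, ← hξ]
          exact (Letter.coedge ξ).isWord
      | mul x y _ _ hx hy => exact hx.mul hy
    exact h
  rw [eq_top_iff]
  intro x _
  refine closure_mono hadj ?_
  have hle : NonUnitalStarAlgebra.adjoin ℂ
      (Set.range (Ambient.rep E).π₀ ∪ Set.range (Ambient.rep E).π₁) ≤
      (NonUnitalStarAlgebra.adjoin ℂ S).map (CStar.incl E) := by
    refine NonUnitalStarAlgebra.adjoin_le ?_
    rintro _ (⟨a, rfl⟩ | ⟨ξ, rfl⟩)
    · exact ⟨_, NonUnitalStarAlgebra.subset_adjoin ℂ _ (Or.inl ⟨a, rfl⟩), rfl⟩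
    · exact ⟨_, NonUnitalStarAlgebra.subset_adjoin ℂ _ (Or.inr ⟨ξ, rfl⟩), rfl⟩
  have hx : CStar.incl E x ∈ closure (NonUnitalStarAlgebra.adjoin ℂ
      (Set.range (Ambient.rep E).π₀ ∪ Set.range (Ambient.rep E).π₁) : Set (Ambient E)) := x.2
  exact closure_subtype.2 (closure_mono hle hx)

end

end TopologicalGraph

theorem mainTheorem4 {V : Type u} {W : Type v}
    [TopologicalSpace V] [LocallyCompactSpace V] [T2Space V] [MeasurableSpace V] [BorelSpace V]
    [TopologicalSpace W] [LocallyCompactSpace W] [T2Space W] (E : TopologicalGraph V W)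
    (τ : TopologicalGraph.CStar E →L[ℂ] ℂ) (hτ : TopologicalGraph.IsTracialState τ)
    (hcycle : ∀ (n : ℕ) (α : Fin (n + 1) → W), E.IsCycle α →
      E.s (α (Fin.last n)) ∉ (TopologicalGraph.inducedMeasure hτ).support) :
    ∀ (z : Circle) (x : TopologicalGraph.CStar E),
      τ (TopologicalGraph.CStar.gauge E z x) = τ x := by
  open TopologicalGraph in
  intro z x
  have hcont : Continuous (CStar.gauge E z) :=
    AddMonoidHomClass.continuous_of_bound (CStar.gauge E z) 1 fun y => by
      simpa using NonUnitalStarAlgHom.norm_apply_le (CStar.gauge E z) y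
  have hx : x ∈ (Submodule.span ℂ {x : CStar E | IsWord x}).topologicalClosure :=
    dense_span_isWord E ▸ Submodule.mem_top
  refine closure_minimal (t := {x | τ (CStar.gauge E z x) = τ x}) (fun y hy => ?_)
    (isClosed_eq (τ.continuous.comp hcont) τ.continuous) hx
  change τ (CStar.gauge E z y) = τ y
  induction hy using Submodule.span_induction with
  | mem y hy =>
    obtain ⟨l, hl, hlz⟩ := hy
    rw [hlz, map_smul]
    by_cases h0 : wordDegree l = 0
    · rw [h0, zpow_zero, one_smul]
    · rw [← unitizationTrace_inr y, hl,
        trace_wordProd_eq_zero hτ (fun n ξ => trace_prod_π₁_eq_zero hτ hcycle ξ) l h0, smul_zero]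
  | zero => rw [map_zero]
  | add y w _ _ hy hw => rw [map_add, map_add, map_add, hy, hw]
  | smul c y _ hy => rw [map_smul, map_smul, map_smul, hy]
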